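/- Let $W^1,\dots,W^n,B$ be independent standard Brownian motions on a probability space $(\Omega,\mathcal F,\mathbb P)$ and let $\mathbb F=(\mathcal F_t)$ be the filtration they generate, augmented by the null events. For $i=1,\dots,n$ let $\mu_i>0$, $\sigma_i,\nu_i\ge 0$ with $\sigma_i+\nu_i>0$, $\delta_i>0$ and $\theta_i\in[0,1]$ be constants, and put $$U_i(x,y)=-\exp\Big\{-\tfrac1{\delta_i}\big(1-\tfrac{\theta_i}{n}\big)x+\tfrac{\theta_i}{\delta_i}y\Big\},\qquad \overline z^{(i)}=\tfrac1n\sum_{k\ne i}z^k\quad(z\in\mathbb R^n).$$ Let $(\Pi^i,C^i)_{i=1}^n$ be a DF (deterministic-feedback) strategy on $[0,T]$: each $\Pi^i:[0,T]\to\mathbb R$ is continuous and $C^i(t,x)=\sum_{k=1}^n p^{i,k}(t)x^k+q^i(t)$ with continuous $p^{i,k},q^i:[0,T]\to\mathbb R$. Let $0\le t_0<T$ and $x_0\in\mathbb R^n$, and consider the closed-loop system on $[t_0,T]$ $$dX^i_t=\big(\Pi^i(t)\mu_i-C^i(t,X_t)\big)dt+\Pi^i(t)\nu_i\,dW^i_t+\Pi^i(t)\sigma_i\,dB_t,\qquad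 X^i_{t_0}=x^i_0,\qquad i=1,\dots,n. \quad(*)$$ Then: 1. $(*)$ is a linear SDE $dX_t=(A(t)X_t+b(t))\,dt+D(t)\,d(W^1,\dots,W^n,B)^\top_t$, $X_{t_0}=x_0$, with continuous deterministic $A:[0,T]\to\mathbb R^{n\times n}$, $b:[0,T]\to\mathbb R^n$, $D:[0,T]\to\mathbb R^{n\times(n+1)}$. 2. $(*)$ has a continuous $\mathbb F$-adapted solution $X$, unique up to indistinguishability, and $\mathbb E\big[\sup_{t\in[t_0,T]}|X_t|^2\big]<\infty$. 3. The outcome $\pi^i_t=\Pi^i(t)$, $c^i_t=C^i(t,X_t)$ is admissible: $\pi^i$ and $c^i$ are $\mathbb F$-progressively measurable on $[t_0,T]$ with $\mathbb E\int_{t_0}^T(|\pi^i_t|^2+|c^i_t|^2)\,dt<\infty$ for every $i$; and $X$ is the wealth process of these controls, i.e. $dX^i_t=\pi^i_t(\mu_i\,dt+\nu_i\,dW^i_t+\sigma_i\,dB_t)-c^i_t\,dt$, $X^i_{t_0}=x_0^i$. 4. For every continuous $\beta:[t_0,T]\to\mathbb R^n$ the family $\{\exp(\beta(t)^\top X_t):t\in[t_0,T]\}$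 is uniformly integrable. 5. For every $i$, $U_i(X^i_T,\overline X^{(i)}_T)$ is $\mathcal F_T$-measurable and square integrable, and $$\mathbb E\Big[\int_{t_0}^T\big|U_i(c^i_t,\overline c^{(i)}_t)\big|^2dt+\big|U_i(X^i_T,\overline X^{(i)}_T)\big|^2\Big]<\infty .$$ -/

import Mathlib

open MeasureTheory ProbabilityTheory Filter Topology
open scoped NNReal ENNReal

namespace CARAGame

/-! ### Brownian noise and its filtration -/

/-- The `n + 1` driving processes: the idiosyncratic noises `W k` (index `some k`) and the common
noise `B` (index `none`). -/
def noise {Ω : Type*} {n : ℕ} (W : Fin n → ℝ≥0 → Ω → ℝ) (B : ℝ≥0 → Ω → ℝ) :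
    Option (Fin n) → ℝ≥0 → Ω → ℝ
  | some k => W k
  | none => B

/-- The processes `Z j` are independent standard Brownian motions. -/
structure IsBrownianFamily {Ω ι : Type*} [MeasurableSpace Ω] (P : Measure Ω)
    (Z : ι → ℝ≥0 → Ω → ℝ) : Prop where
  measurable : ∀ j t, Measurable (Z j t)
  brownian : ∀ j, IsBrownianReal (Z j) P
  indep : iIndepFun (fun j ω (t : ℝ≥0) => Z j t ω) P

/-- The filtration generated by the processes `Z j`, augmented by the null events. -/
def generatedFiltration {Ω ι : Type*} [mΩ : MeasurableSpace Ω] (P : Measure Ω)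
    (Z : ι → ℝ≥0 → Ω → ℝ) (hZ : ∀ j t, Measurable (Z j t)) : Filtration ℝ≥0 mΩ where
  seq t := (⨆ j, ⨆ s, ⨆ _ : s ≤ t, MeasurableSpace.comap (Z j s) inferInstance) ⊔
    MeasurableSpace.generateFrom {N : Set Ω | MeasurableSet N ∧ P N = 0}
  mono' := by
    intro s t hst
    refine sup_le_sup_right (iSup_le fun j => iSup_le fun r => iSup_le fun hr => ?_) _
    exact le_iSup_of_le j (le_iSup_of_le r (le_iSup_of_le (hr.trans hst) le_rfl))
  le' := fun _ => sup_le
    (iSup_le fun j => iSup_le fun s => iSup_le fun _ => (hZ j s).comap_le)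
    (MeasurableSpace.generateFrom_le fun _ hN => hN.1)

/-! ### Spaces of processes on `[t₀, T]`

Processes are indexed by real times; only their values on `[t₀, T]` (with `0 ≤ t₀`) matter. -/

/-- Adapted processes on `[t₀, T]` with continuous paths. -/
def IsContinuousAdapted {Ω E : Type*} {mΩ : MeasurableSpace Ω} [TopologicalSpace E]
    [MeasurableSpace E] (𝔽 : Filtration ℝ≥0 mΩ) (t₀ T : ℝ) (Y : ℝ → Ω → E) : Prop :=
  (∀ t ∈ Set.Icc t₀ T, Measurable[𝔽 t.toNNReal] (Y t)) ∧
    ∀ ω, ContinuousOn (fun t => Y t ω) (Set.Icc t₀ T)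

/-- Progressively measurable processes on `[t₀, T]`. -/
def IsProgressiveOn {Ω E : Type*} {mΩ : MeasurableSpace Ω} [MeasurableSpace E]
    (𝔽 : Filtration ℝ≥0 mΩ) (t₀ T : ℝ) (Z : ℝ → Ω → E) : Prop :=
  ∀ s ∈ Set.Icc t₀ T, Measurable[Subtype.instMeasurableSpace.prod (𝔽 s.toNNReal)]
    fun p : Set.Icc t₀ s × Ω => Z p.1 p.2

/-- The space `𝕊²` : continuous adapted processes with `E[sup |Y|²] < ∞`. -/
def MemS2 {Ω E : Type*} {mΩ : MeasurableSpace Ω} [NormedAddCommGroup E] [MeasurableSpace E]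
    (P : Measure Ω) (𝔽 : Filtration ℝ≥0 mΩ) (t₀ T : ℝ) (Y : ℝ → Ω → E) : Prop :=
  IsContinuousAdapted 𝔽 t₀ T Y ∧ ∫⁻ ω, (⨆ t ∈ Set.Icc t₀ T, ‖Y t ω‖ₑ ^ 2) ∂P < ∞

/-- The space `ℍ²` : progressively measurable processes with `E[∫ |Z|² ds] < ∞`. -/
def MemH2 {Ω E : Type*} {mΩ : MeasurableSpace Ω} [NormedAddCommGroup E] [MeasurableSpace E]
    (P : Measure Ω) (𝔽 : Filtration ℝ≥0 mΩ) (t₀ T : ℝ) (Z : ℝ → Ω → E) : Prop :=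
  IsProgressiveOn 𝔽 t₀ T Z ∧ ∫⁻ ω, (∫⁻ s in Set.Icc t₀ T, ‖Z s ω‖ₑ ^ 2) ∂P < ∞

/-- The space `L²` of `m`-measurable square integrable real random variables. -/
def MemL2 {Ω : Type*} {mΩ : MeasurableSpace Ω} (P : Measure Ω) (m : MeasurableSpace Ω)
    (ξ : Ω → ℝ) : Prop :=
  Measurable[m] ξ ∧ MemLp ξ 2 P

/-! ### The Itô integral -/

/-- A simple process `∑ k < N, ξ k · 1_{(grid k, grid (k + 1)]}` on `[t₀, T]`, where `ξ k` is
bounded and measurable with respect to the information at time `grid k`. -/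
structure SimpleProcess {Ω : Type*} {mΩ : MeasurableSpace Ω} (𝔽 : Filtration ℝ≥0 mΩ)
    (t₀ T : ℝ) where
  N : ℕ
  grid : ℕ → ℝ
  grid_mono : Monotone grid
  grid_mem : ∀ k, grid k ∈ Set.Icc t₀ T
  ξ : ℕ → Ω → ℝ
  ξ_meas : ∀ k, Measurable[𝔽 (grid k).toNNReal] (ξ k)
  ξ_bdd : ∀ k, ∃ C : ℝ, ∀ ω, |ξ k ω| ≤ C

namespace SimpleProcess

variable {Ω : Type*} {mΩ : MeasurableSpace Ω} {𝔽 : Filtration ℝ≥0 mΩ} {t₀ T : ℝ}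

/-- The value of the simple process at time `s`. -/
noncomputable def value (H : SimpleProcess 𝔽 t₀ T) (s : ℝ) (ω : Ω) : ℝ :=
  ∑ k ∈ Finset.range H.N,
    (Set.Ioc (H.grid k) (H.grid (k + 1))).indicator (fun _ => H.ξ k ω) s

/-- The stochastic integral from `t₀` to `t` of the simple process against `Z`. -/
noncomputable def integral (H : SimpleProcess 𝔽 t₀ T) (Z : ℝ≥0 → Ω → ℝ) (t : ℝ) (ω : Ω) : ℝ :=
  ∑ k ∈ Finset.range H.N, H.ξ k ω *
    (Z (min (H.grid (k + 1)) t).toNNReal ω - Z (min (H.grid k) t).toNNReal ω)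

end SimpleProcess

/-- `I` is a continuous version of the Itô integral `I t = ∫_{t₀}^t H dZ`, `t ∈ [t₀, T]`, of the
integrand `H ∈ ℍ²` against the Brownian motion `Z`: the `L²` limit of the integrals of simple
processes that converge to `H` in `ℍ²`. -/
def IsItoIntegral {Ω : Type*} {mΩ : MeasurableSpace Ω} (P : Measure Ω) (𝔽 : Filtration ℝ≥0 mΩ)
    (t₀ T : ℝ) (Z : ℝ≥0 → Ω → ℝ) (H I : ℝ → Ω → ℝ) : Prop :=
  MemH2 P 𝔽 t₀ T H ∧ IsContinuousAdapted 𝔽 t₀ T I ∧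
    ∃ S : ℕ → SimpleProcess 𝔽 t₀ T,
      Tendsto (fun m => ∫⁻ ω, (∫⁻ s in Set.Icc t₀ T, ‖(S m).value s ω - H s ω‖ₑ ^ 2) ∂P)
        atTop (𝓝 0) ∧
      ∀ t ∈ Set.Icc t₀ T,
        Tendsto (fun m => ∫⁻ ω, ‖(S m).integral Z t ω - I t ω‖ₑ ^ 2 ∂P) atTop (𝓝 0)

/-! ### Itô processes and stochastic differential equations in `ℝⁿ` -/

/-- `X` is a continuous adapted `ℝⁿ`-valued process on `[t₀, T]` with
`dX^i = drift i dt + ∑ j, diff i j dZ^j` and `X_{t₀} = x₀`. -/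
def IsItoProcess {Ω ι : Type*} {mΩ : MeasurableSpace Ω} [Fintype ι] {n : ℕ} (P : Measure Ω)
    (𝔽 : Filtration ℝ≥0 mΩ) (Z : ι → ℝ≥0 → Ω → ℝ) (t₀ T : ℝ) (x₀ : EuclideanSpace ℝ (Fin n))
    (drift : Fin n → ℝ → Ω → ℝ) (diff : Fin n → ι → ℝ → Ω → ℝ)
    (X : ℝ → Ω → EuclideanSpace ℝ (Fin n)) : Prop :=
  IsContinuousAdapted 𝔽 t₀ T X ∧
    (∀ i, ∀ᵐ ω ∂P, IntegrableOn (fun s => drift i s ω) (Set.Icc t₀ T)) ∧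
    ∃ I : Fin n → ι → ℝ → Ω → ℝ,
      (∀ i j, IsItoIntegral P 𝔽 t₀ T (Z j) (diff i j) (I i j)) ∧
      ∀ᵐ ω ∂P, ∀ t ∈ Set.Icc t₀ T, ∀ i,
        X t ω i = x₀ i + (∫ s in t₀..t, drift i s ω) + ∑ j, I i j t ω

/-- `X` is a (strong) solution on `[t₀, T]` of the stochastic differential equation
`dX^i = b i (t, X) dt + ∑ j, a i j (t, X) dZ^j`, `X_{t₀} = x₀`. -/
def IsSDESolution {Ω ι : Type*} {mΩ : MeasurableSpace Ω} [Fintype ι] {n : ℕ} (P : Measure Ω)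
    (𝔽 : Filtration ℝ≥0 mΩ) (Z : ι → ℝ≥0 → Ω → ℝ) (t₀ T : ℝ) (x₀ : EuclideanSpace ℝ (Fin n))
    (b : Fin n → ℝ → EuclideanSpace ℝ (Fin n) → ℝ)
    (a : Fin n → ι → ℝ → EuclideanSpace ℝ (Fin n) → ℝ)
    (X : ℝ → Ω → EuclideanSpace ℝ (Fin n)) : Prop :=
  IsItoProcess P 𝔽 Z t₀ T x₀ (fun i t ω => b i t (X t ω)) (fun i j t ω => a i j t (X t ω)) X

/-! ### The game -/

/-- Market and preference parameters of the `n` agents. -/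
structure Params (n : ℕ) where
  μ : Fin n → ℝ
  ν : Fin n → ℝ
  σ : Fin n → ℝ
  δ : Fin n → ℝ
  θ : Fin n → ℝ
  μ_pos : ∀ i, 0 < μ i
  ν_nonneg : ∀ i, 0 ≤ ν i
  σ_nonneg : ∀ i, 0 ≤ σ i
  vol_pos : ∀ i, 0 < σ i + ν i
  δ_pos : ∀ i, 0 < δ i
  θ_mem : ∀ i, θ i ∈ Set.Icc (0 : ℝ) 1

/-- The average `(1/n) ∑_{k ≠ i} x^k` over the other agents. -/
noncomputable def othersMean {n : ℕ} (i : Fin n) (x : Fin n → ℝ) : ℝ :=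
  (1 / (n : ℝ)) * ∑ k ∈ Finset.univ.erase i, x k

/-- The utility of agent `i` as a function of `x^i` and the average over the other agents. -/
noncomputable def Params.utility {n : ℕ} (κ : Params n) (i : Fin n) (x y : ℝ) : ℝ :=
  -Real.exp (-(1 / κ.δ i) * (1 - κ.θ i / n) * x + κ.θ i / κ.δ i * y)

/-- The volatility loading of the wealth of agent `i`, who holds the amount `p` of stock `i`, on
the noise with index `j`. -/
def Params.loading {n : ℕ} (κ : Params n) (i : Fin n) (p : ℝ) : Option (Fin n) → ℝ
  | some k => if k = i then p * κ.ν i else 0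
  | none => p * κ.σ i

/-- `X` is the wealth process of the agents under the controls `(π, c)`:
`dX^i = π^i (μ_i dt + ν_i dW^i + σ_i dB) - c^i dt`, `X_{t₀} = x₀`. -/
def IsWealth {Ω : Type*} {mΩ : MeasurableSpace Ω} {n : ℕ} (κ : Params n) (P : Measure Ω)
    (𝔽 : Filtration ℝ≥0 mΩ) (W : Fin n → ℝ≥0 → Ω → ℝ) (B : ℝ≥0 → Ω → ℝ) (t₀ T : ℝ)
    (x₀ : EuclideanSpace ℝ (Fin n)) (π c : Fin n → ℝ → Ω → ℝ)
    (X : ℝ → Ω → EuclideanSpace ℝ (Fin n)) : Prop :=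
  IsItoProcess P 𝔽 (noise W B) t₀ T x₀ (fun i t ω => π i t ω * κ.μ i - c i t ω)
    (fun i j t ω => κ.loading i (π i t ω) j) X

/-- The `n`-tuple of controls `(π, c)` is admissible over `[t₀, T]`. -/
def IsAdmissible {Ω : Type*} {mΩ : MeasurableSpace Ω} {n : ℕ} (P : Measure Ω)
    (𝔽 : Filtration ℝ≥0 mΩ) (t₀ T : ℝ) (π c : Fin n → ℝ → Ω → ℝ) : Prop :=
  ∀ i, MemH2 P 𝔽 t₀ T (π i) ∧ MemH2 P 𝔽 t₀ T (c i)

/-- The integrability condition over `[t₀, T]` for the controls `(π, c)`: they are admissible, their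
wealth process exists, and the utilities of consumption and terminal wealth are square
integrable. -/
def IntegrabilityCondition {Ω : Type*} {mΩ : MeasurableSpace Ω} {n : ℕ} (κ : Params n)
    (P : Measure Ω) (𝔽 : Filtration ℝ≥0 mΩ) (W : Fin n → ℝ≥0 → Ω → ℝ) (B : ℝ≥0 → Ω → ℝ)
    (t₀ T : ℝ) (x₀ : EuclideanSpace ℝ (Fin n)) (π c : Fin n → ℝ → Ω → ℝ) : Prop :=
  IsAdmissible P 𝔽 t₀ T π c ∧ (∃ X, IsWealth κ P 𝔽 W B t₀ T x₀ π c X) ∧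
    ∀ X, IsWealth κ P 𝔽 W B t₀ T x₀ π c X → ∀ i,
      ∫⁻ ω, ((∫⁻ t in Set.Icc t₀ T,
          ‖κ.utility i (c i t ω) (othersMean i fun k => c k t ω)‖ₑ ^ 2) +
        ‖κ.utility i (X T ω i) (othersMean i fun k => X T ω k)‖ₑ ^ 2) ∂P < ∞

/-- `(Pol, Con)` is a deterministic-feedback strategy: the amounts `Pol i` invested are continuous
functions of time, and the consumption rates `Con i` are affine in the state with continuous
coefficients. -/
def IsDFStrategy {n : ℕ} (T : ℝ) (Pol : Fin n → ℝ → ℝ)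
    (Con : Fin n → ℝ → EuclideanSpace ℝ (Fin n) → ℝ) : Prop :=
  ∀ i, ContinuousOn (Pol i) (Set.Icc 0 T) ∧
    ∃ (p : Fin n → ℝ → ℝ) (q : ℝ → ℝ),
      (∀ k, ContinuousOn (p k) (Set.Icc 0 T)) ∧ ContinuousOn q (Set.Icc 0 T) ∧
      ∀ t ∈ Set.Icc 0 T, ∀ x, Con i t x = ∑ k, p k t * x k + q t

/-- Drift coefficients of the closed-loop system. -/
def closedLoopDrift {n : ℕ} (κ : Params n) (Pol : Fin n → ℝ → ℝ)
    (Con : Fin n → ℝ → EuclideanSpace ℝ (Fin n) → ℝ) (i : Fin n) (t : ℝ)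
    (x : EuclideanSpace ℝ (Fin n)) : ℝ :=
  Pol i t * κ.μ i - Con i t x

/-- Diffusion coefficients of the closed-loop system. -/
def closedLoopDiff {n : ℕ} (κ : Params n) (Pol : Fin n → ℝ → ℝ) (i : Fin n)
    (j : Option (Fin n)) (t : ℝ) (_x : EuclideanSpace ℝ (Fin n)) : ℝ :=
  κ.loading i (Pol i t) j

/-- `X` solves the closed-loop system on `[t₀, T]` from `x₀` when the agents use `(Pol, Con)`:
`dX^i = (Pol^i μ_i - Con^i(t, X)) dt + Pol^i ν_i dW^i + Pol^i σ_i dB`, `X_{t₀} = x₀`. -/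
def IsClosedLoopSolution {Ω : Type*} {mΩ : MeasurableSpace Ω} {n : ℕ} (κ : Params n)
    (P : Measure Ω) (𝔽 : Filtration ℝ≥0 mΩ) (W : Fin n → ℝ≥0 → Ω → ℝ) (B : ℝ≥0 → Ω → ℝ)
    (t₀ T : ℝ) (x₀ : EuclideanSpace ℝ (Fin n)) (Pol : Fin n → ℝ → ℝ)
    (Con : Fin n → ℝ → EuclideanSpace ℝ (Fin n) → ℝ)
    (X : ℝ → Ω → EuclideanSpace ℝ (Fin n)) : Prop :=
  IsSDESolution P 𝔽 (noise W B) t₀ T x₀ (closedLoopDrift κ Pol Con) (closedLoopDiff κ Pol) X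

/-- `X` solves the linear equation `dX = (A(t) X + b(t)) dt + D(t) d(W, B)`, `X_{t₀} = x₀`. -/
def IsLinearSDESolution {Ω : Type*} {mΩ : MeasurableSpace Ω} {n : ℕ}
    (P : Measure Ω) (𝔽 : Filtration ℝ≥0 mΩ) (W : Fin n → ℝ≥0 → Ω → ℝ) (B : ℝ≥0 → Ω → ℝ)
    (t₀ T : ℝ) (x₀ : EuclideanSpace ℝ (Fin n)) (A : ℝ → Matrix (Fin n) (Fin n) ℝ)
    (b : ℝ → Fin n → ℝ) (D : ℝ → Matrix (Fin n) (Option (Fin n)) ℝ)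
    (X : ℝ → Ω → EuclideanSpace ℝ (Fin n)) : Prop :=
  IsSDESolution P 𝔽 (noise W B) t₀ T x₀ (fun i t x => ∑ k, A t i k * x k + b t i)
    (fun i j t _ => D t i j) X

end CARAGame

namespace CARAGame

/-! Under a deterministic-feedback strategy the volatility loadings are deterministic and only the
drift sees the state, affinely. The closed loop is therefore a linear equation with additive noise,
and its stochastic integrals are Wiener integrals of continuous functions. Once these are fixed as
continuous paths `y`, what remains for each `ω` is the integral equation `x t = x₀ + ∫ (A x + b) + y
t`. Picard iteration solves it and Gronwall's inequality makes the solution unique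
(`linearSDE_exists`, `linearSDE_ae_eq`).

All integrability comes from one random variable. Gronwall bounds `∑ k, |X t k|`, uniformly in `t`,
by an affine function of the maxima of the Wiener integrals. Such a maximum has Gaussian tails, by
Doob's inequality for the exponential submartingale (`IsBrownianFor.measure_exists_lt_abs_dyadic`),
so all its exponential moments are finite (`exists_hasExpMoments_of_tail`). Hence some `M` with
`HasExpMoments P M` dominates the state (`linearSDE_exists_hasExpMoments`) and, after an affine
enlargement, the consumption. The `𝕊²` and `ℍ²` bounds, the uniform integrability and the square
integrability of the utilities all follow by domination with `exp (c * M)`.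

The Wiener integral is the almost sure uniform limit of integrals of dyadic step functions; the tail
bound and Borel–Cantelli give the convergence (`IsBrownianFor.exists_isItoIntegral`). A solution may
come with any version of the Itô integral, so estimates for the constructed version are transferred
by uniqueness of the integral (`IsItoIntegral.ae_eq`), which rests on the isometry for simple
integrands (`IsBrownianFor.lintegral_sum_mul_sub_sq`). -/

/-- `Z` is a Brownian motion relative to the filtration `𝔽`, which contains the null events. -/
structure IsBrownianFor {Ω : Type*} {mΩ : MeasurableSpace Ω} (P : Measure Ω)
    (𝔽 : Filtration ℝ≥0 mΩ) (Z : ℝ≥0 → Ω → ℝ) : Prop where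
  adapted : ∀ t, Measurable[𝔽 t] (Z t)
  cont : ∀ᵐ ω ∂P, Continuous (Z · ω)
  law : ∀ s t, s ≤ t → HasLaw (fun ω => Z t ω - Z s ω) (gaussianReal 0 (t - s)) P
  indep : ∀ s t, s ≤ t →
    Indep (MeasurableSpace.comap (fun ω => Z t ω - Z s ω) inferInstance) (𝔽 s) P
  null_mem : ∀ N, MeasurableSet N → P N = 0 → MeasurableSet[𝔽 0] N

/-! ### Independence of σ-algebras. -/

section Independence

variable {Ω : Type*} {mΩ : MeasurableSpace Ω} {P : Measure Ω}

/-- If `m₁` is independent of `m₂`, and `m₃` of `m₁ ⊔ m₂`, then `m₁` is independent of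
`m₂ ⊔ m₃`. -/
lemma indep_sup_of_indep [IsProbabilityMeasure P] {m₁ m₂ m₃ : MeasurableSpace Ω}
    (h₁ : m₁ ≤ mΩ) (h₂ : m₂ ≤ mΩ)
    (h₃ : m₃ ≤ mΩ) (h₁₂ : Indep m₁ m₂ P) (h : Indep (m₁ ⊔ m₂) m₃ P) : Indep m₁ (m₂ ⊔ m₃) P := by
  -- The intersections `t ∩ u` form a generating π-system, so it is enough to factor `P (s ∩ t ∩
  -- u)`: split off `u`, then separate `s` from `t`.
  have hgen : m₂ ⊔ m₃ = MeasurableSpace.generateFrom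
      (Set.image2 (· ∩ ·) {s | MeasurableSet[m₂] s} {s | MeasurableSet[m₃] s}) := by
    apply le_antisymm
    · refine sup_le (fun s hs => ?_) (fun s hs => ?_)
      · exact MeasurableSpace.measurableSet_generateFrom
          ⟨s, hs, Set.univ, MeasurableSet.univ, Set.inter_univ s⟩
      · exact MeasurableSpace.measurableSet_generateFrom
          ⟨Set.univ, MeasurableSet.univ, s, hs, Set.univ_inter s⟩
    · refine MeasurableSpace.generateFrom_le ?_
      rintro _ ⟨s, hs, t, ht, rfl⟩
      exact MeasurableSet.inter ((le_sup_left : m₂ ≤ m₂ ⊔ m₃) _ hs)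
        ((le_sup_right : m₃ ≤ m₂ ⊔ m₃) _ ht)
  refine IndepSets.indep h₁ (sup_le h₂ h₃) (@MeasurableSpace.isPiSystem_measurableSet _ m₁)
    ?_ (@MeasurableSpace.generateFrom_measurableSet _ m₁).symm hgen ?_
  · rintro _ ⟨s, hs, t, ht, rfl⟩ _ ⟨s', hs', t', ht', rfl⟩ -
    exact ⟨s ∩ s', MeasurableSet.inter hs hs', t ∩ t', MeasurableSet.inter ht ht',
      by simp only; ac_rfl⟩
  · rw [IndepSets_iff]
    rintro s _ hs ⟨t, ht, u, hu, rfl⟩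
    have e₁ := (Indep_iff _ _ _).1 h₁₂ s t hs ht
    have e₂ := (Indep_iff _ _ _).1 h (s ∩ t) u
      (MeasurableSet.inter ((le_sup_left : m₁ ≤ m₁ ⊔ m₂) _ hs)
        ((le_sup_right : m₂ ≤ m₁ ⊔ m₂) _ ht)) hu
    have e₃ := (Indep_iff _ _ _).1 h t u ((le_sup_right : m₂ ≤ m₁ ⊔ m₂) _ ht) hu
    rw [← Set.inter_assoc, e₂, e₁, e₃, mul_assoc]

/-- Independence is not affected by adjoining null events. -/
lemma indep_sup_null {m₁ m₂ : MeasurableSpace Ω} (h : Indep m₁ m₂ P) :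
    Indep m₁ (m₂ ⊔ MeasurableSpace.generateFrom {N : Set Ω | MeasurableSet[mΩ] N ∧ P N = 0}) P := by
  -- Each event of the augmented σ-algebra agrees almost surely with an event of `m₂`, and
  -- probabilities do not see the difference.
  have hle : m₂ ⊔ MeasurableSpace.generateFrom {N : Set Ω | MeasurableSet[mΩ] N ∧ P N = 0} ≤
      eventuallyMeasurableSpace m₂ (ae P) := by
    refine sup_le le_eventuallyMeasurableSpace (MeasurableSpace.generateFrom_le ?_)
    rintro N ⟨-, hN⟩
    exact ⟨∅, MeasurableSet.empty, ae_eq_empty.2 hN⟩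
  rw [Indep_iff]
  intro s t hs ht
  obtain ⟨t', ht', htt'⟩ := hle _ ht
  rw [measure_congr htt', measure_congr ((ae_eq_refl s).inter htt')]
  exact (Indep_iff _ _ _).1 h s t' hs ht'

end Independence

/-! ### Brownian families relative to their augmented filtration. -/

section Family

variable {Ω ι : Type*} [mΩ : MeasurableSpace Ω] {P : Measure Ω}

/-- The past of the family is generated by the past of `Z j`, independent of the increment because
`Z j` has independent increments, and by pasts of the other motions, independent of everything that
`Z j` generates. `indep_sup_of_indep` glues the two. -/
lemma IsBrownianFamily.indep_increment [IsProbabilityMeasure P] {Z : ι → ℝ≥0 → Ω → ℝ}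
    (hZ : IsBrownianFamily P Z) (j : ι) {s t : ℝ≥0} (hst : s ≤ t) :
    Indep (MeasurableSpace.comap (fun ω => Z j t ω - Z j s ω) inferInstance)
      (⨆ k, ⨆ r, ⨆ _ : r ≤ s, MeasurableSpace.comap (Z k r) inferInstance) P := by
  have h₁₂ : Indep (MeasurableSpace.comap (fun ω => Z j t ω - Z j s ω) inferInstance)
      (MeasurableSpace.comap (fun ω (r : Set.Iic s) => Z j r ω) inferInstance) P := by
    have h := (hZ.brownian j).toIsPreBrownianReal.indepFun_shift s
    have hφ : Measurable fun f : ℝ≥0 → ℝ => f (t - s) := measurable_pi_apply (t - s)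
    have h' := h.comp hφ measurable_id
    have e : ((fun f : ℝ≥0 → ℝ => f (t - s)) ∘ fun ω r => Z j (s + r) ω - Z j s ω) =
        fun ω => Z j t ω - Z j s ω := by
      ext ω; simp [add_tsub_cancel_of_le hst]
    rw [e] at h'
    exact h'
  set G : ι → MeasurableSpace Ω :=
    fun k => MeasurableSpace.comap (fun ω (t : ℝ≥0) => Z k t ω) inferInstance with hG
  have hGle : ∀ k, G k ≤ mΩ := fun k =>
    (measurable_pi_lambda _ fun t => hZ.measurable k t).comap_le
  have hGmeas : ∀ k r, Measurable[G k] (Z k r) := fun k r =>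
    (measurable_pi_apply r).comp (comap_measurable (fun ω (t : ℝ≥0) => Z k t ω))
  have hind : iIndep G P := hZ.indep
  set past : MeasurableSpace Ω :=
    MeasurableSpace.comap (fun ω (r : Set.Iic s) => Z j r ω) inferInstance with hpast
  set inc : MeasurableSpace Ω :=
    MeasurableSpace.comap (fun ω => Z j t ω - Z j s ω) inferInstance with hinc
  have hincG : inc ≤ G j := ((hGmeas j t).sub (hGmeas j s)).comap_le
  have hpastG : past ≤ G j :=
    (@measurable_pi_lambda _ _ _ (G j) _ _ fun r : Set.Iic s => hGmeas j r).comap_le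
  have h₃ : Indep (G j) (⨆ k ∈ ({j}ᶜ : Set ι), G k) P := by
    have := indep_iSup_of_disjoint hGle hind (S := {j}) (T := {j}ᶜ)
      (Set.disjoint_compl_right_iff_subset.2 subset_rfl)
    simpa using this
  have hfull := indep_sup_of_indep (hincG.trans (hGle j)) (hpastG.trans (hGle j))
    (iSup₂_le fun k _ => hGle k) h₁₂ (indep_of_indep_of_le_left h₃ (sup_le hincG hpastG))
  refine indep_of_indep_of_le_right hfull (iSup_le fun k => iSup_le fun r => iSup_le fun hr => ?_)
  by_cases hk : k = j
  · subst hk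
    refine le_sup_of_le_left (Measurable.comap_le ?_)
    exact (measurable_pi_apply (⟨r, hr⟩ : Set.Iic s)).comp
      (comap_measurable (fun ω (r : Set.Iic s) => Z k r ω))
  · exact le_sup_of_le_right (le_iSup₂_of_le k hk (hGmeas k r).comap_le)

lemma IsBrownianFamily.isBrownianFor [IsProbabilityMeasure P] {Z : ι → ℝ≥0 → Ω → ℝ}
    (hZ : IsBrownianFamily P Z) (j : ι) :
    IsBrownianFor P (generatedFiltration P Z hZ.measurable) (Z j) where
  adapted t := by
    refine Measurable.mono (comap_measurable (Z j t)) ?_ le_rfl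
    exact le_sup_of_le_left
      (le_iSup_of_le j (le_iSup_of_le t (le_iSup_of_le le_rfl le_rfl)))
  cont := (hZ.brownian j).cont
  law s t hst := by
    have h := (hZ.brownian j).toIsPreBrownianReal.hasLaw_sub t s
    have e : nndist t.1 s.1 = t - s := by
      apply NNReal.eq
      rw [coe_nndist, Real.dist_eq, NNReal.coe_sub hst]
      exact abs_of_nonneg (sub_nonneg.2 (NNReal.coe_le_coe.2 hst))
    rw [e] at h
    exact h
  indep s t hst := indep_sup_null (hZ.indep_increment j hst)
  null_mem N hN hN0 :=
    (le_sup_right : _ ≤ _ ⊔ MeasurableSpace.generateFrom {N : Set Ω | MeasurableSet N ∧ P N = 0}) _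
      (MeasurableSpace.measurableSet_generateFrom ⟨hN, hN0⟩)

end Family

/-! ### Moments of Brownian increments. -/

namespace IsBrownianFor

variable {Ω : Type*} {mΩ : MeasurableSpace Ω} {P : Measure Ω}
  {𝔽 : Filtration ℝ≥0 mΩ} {Z : ℝ≥0 → Ω → ℝ}

lemma measurable (hZ : IsBrownianFor P 𝔽 Z) (t : ℝ≥0) : Measurable (Z t) :=
  (hZ.adapted t).mono (𝔽.le t) le_rfl

/-- The exceptional set belongs to every `𝔽 t`, so a process may be redefined on it without losing
adaptedness. -/
lemma null_mem_of_ae (hZ : IsBrownianFor P 𝔽 Z) {p : Ω → Prop} (hp : ∀ᵐ ω ∂P, p ω) :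
    ∃ N : Set Ω, P N = 0 ∧ (∀ t, MeasurableSet[𝔽 t] N) ∧ ∀ ω, ω ∉ N → p ω := by
  refine ⟨toMeasurable P {ω | ¬ p ω}, by rw [measure_toMeasurable]; exact hp, fun t => ?_,
    fun ω hω => ?_⟩
  · refine 𝔽.mono (zero_le) _ (hZ.null_mem _ (measurableSet_toMeasurable _ _) ?_)
    rw [measure_toMeasurable]; exact hp
  · by_contra h
    exact hω (subset_toMeasurable _ _ h)

lemma indepFun (hZ : IsBrownianFor P 𝔽 Z) {s t : ℝ≥0} (hst : s ≤ t) {Y : Ω → ℝ}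
    (hY : Measurable[𝔽 s] Y) : IndepFun Y (fun ω => Z t ω - Z s ω) P :=
  (indep_of_indep_of_le_right (hZ.indep s t hst) hY.comap_le).symm

lemma memLp_sub (hZ : IsBrownianFor P 𝔽 Z) {s t : ℝ≥0} (hst : s ≤ t) :
    MemLp (fun ω => Z t ω - Z s ω) 2 P :=
  (hZ.law s t hst).hasGaussianLaw.memLp_two

lemma integral_sub (hZ : IsBrownianFor P 𝔽 Z) {s t : ℝ≥0} (hst : s ≤ t) :
    ∫ ω, (Z t ω - Z s ω) ∂P = 0 := by
  rw [(hZ.law s t hst).integral_eq, integral_id_gaussianReal]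

lemma integral_sub_sq [IsProbabilityMeasure P] (hZ : IsBrownianFor P 𝔽 Z) {s t : ℝ≥0}
    (hst : s ≤ t) :
    ∫ ω, (Z t ω - Z s ω) ^ 2 ∂P = t - s := by
  have h := (hZ.law s t hst).variance_eq
  rw [variance_id_gaussianReal, variance_eq_sub (hZ.memLp_sub hst), hZ.integral_sub hst] at h
  simp only [Pi.pow_apply] at h
  rw [NNReal.coe_sub hst] at h
  linarith

lemma integral_exp_sub (hZ : IsBrownianFor P 𝔽 Z) {s t : ℝ≥0} (hst : s ≤ t) (l : ℝ) :
    ∫ ω, Real.exp (l * (Z t ω - Z s ω)) ∂P = Real.exp ((t - s) * l ^ 2 / 2) := by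
  have h := mgf_gaussianReal (hZ.law s t hst).map_eq l
  rw [mgf] at h
  rw [h, NNReal.coe_sub hst]
  simp

lemma integrable_exp_sub (hZ : IsBrownianFor P 𝔽 Z) {s t : ℝ≥0} (hst : s ≤ t) (l : ℝ) :
    Integrable (fun ω => Real.exp (l * (Z t ω - Z s ω))) P := by
  have h := integrable_exp_mul_gaussianReal (μ := 0) (v := t - s) l
  rw [← (hZ.law s t hst).map_eq] at h
  exact h.comp_aemeasurable (hZ.law s t hst).aemeasurable

end IsBrownianFor

end CARAGame

/-! ### The Itô isometry for sums of weighted increments. -/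

namespace CARAGame

namespace IsBrownianFor

variable {Ω : Type*} {mΩ : MeasurableSpace Ω} {P : Measure Ω}
  {𝔽 : Filtration ℝ≥0 mΩ} {Z : ℝ≥0 → Ω → ℝ}

/-- Integrability of `Y` plays no role: an integral that does not exist counts as zero, and the
product formula for independent factors respects this. -/
lemma integral_mul_sub (hZ : IsBrownianFor P 𝔽 Z) {s t : ℝ≥0}
    (hst : s ≤ t) {Y : Ω → ℝ} (hY : Measurable[𝔽 s] Y) :
    ∫ ω, Y ω * (Z t ω - Z s ω) ∂P = 0 := by
  have h := (hZ.indepFun hst hY).integral_mul_eq_mul_integral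
    (hY.mono (𝔽.le s) le_rfl).aestronglyMeasurable
    ((hZ.measurable t).sub (hZ.measurable s)).aestronglyMeasurable
  rw [hZ.integral_sub hst, mul_zero] at h
  exact h

lemma integral_mul_sub_sq [IsProbabilityMeasure P] (hZ : IsBrownianFor P 𝔽 Z) {s t : ℝ≥0}
    (hst : s ≤ t) {Y : Ω → ℝ} (hY : Measurable[𝔽 s] Y) :
    ∫ ω, Y ω * (Z t ω - Z s ω) ^ 2 ∂P = (∫ ω, Y ω ∂P) * (t - s) := by
  have hsq : Measurable fun x : ℝ => x ^ 2 := by fun_prop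
  have h := ((hZ.indepFun hst hY).comp measurable_id hsq).integral_mul_eq_mul_integral
    (hY.mono (𝔽.le s) le_rfl).aestronglyMeasurable
    (((hZ.measurable t).sub (hZ.measurable s)).pow_const 2).aestronglyMeasurable
  rw [← hZ.integral_sub_sq hst]
  exact h

lemma integrable_mul_sub_mul_sub (hZ : IsBrownianFor P 𝔽 Z) {a b c d : ℝ≥0}
    (hab : a ≤ b) (hcd : c ≤ d) {Y : Ω → ℝ} (hY : Measurable Y) (hYb : ∃ C : ℝ, ∀ ω, |Y ω| ≤ C) :
    Integrable (fun ω => Y ω * ((Z b ω - Z a ω) * (Z d ω - Z c ω))) P := by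
  obtain ⟨C, hC⟩ := hYb
  refine Integrable.bdd_mul (c := C) ?_ hY.aestronglyMeasurable (ae_of_all _ hC)
  exact (hZ.memLp_sub hab).integrable_mul (hZ.memLp_sub hcd)

/-- An increment after time `s` is orthogonal to everything known at time `s`, so only the square of
the increment over the common part of `(a, b]` and `(c, d]` contributes. The factor `max _ 0` is the
length of that part. -/
lemma integral_mul_sub_mul_sub_of_le [IsProbabilityMeasure P] (hZ : IsBrownianFor P 𝔽 Z)
    {a b c d : ℝ≥0} (hab : a ≤ b) (hcd : c ≤ d) (hac : a ≤ c) {Y : Ω → ℝ}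
    (hY : Measurable[𝔽 c] Y) (hYb : ∃ C : ℝ, ∀ ω, |Y ω| ≤ C) :
    ∫ ω, Y ω * ((Z b ω - Z a ω) * (Z d ω - Z c ω)) ∂P =
      (∫ ω, Y ω ∂P) * max (min (b : ℝ) d - max (a : ℝ) c) 0 := by
  have hYm : Measurable Y := hY.mono (𝔽.le c) le_rfl
  have mZ : ∀ {r u}, r ≤ u → Measurable[𝔽 u] (Z r) := fun h => (hZ.adapted _).mono (𝔽.mono h) le_rfl
  -- the part of `(a, b]` before time `c` does not contribute
  have hfirst : ∀ e, a ≤ e → e ≤ c →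
      ∫ ω, Y ω * ((Z e ω - Z a ω) * (Z d ω - Z c ω)) ∂P = 0 := by
    intro e hae hec
    have := hZ.integral_mul_sub hcd (Y := fun ω => Y ω * (Z e ω - Z a ω))
      (hY.mul ((mZ hec).sub (mZ hac)))
    simpa only [mul_assoc] using this
  rcases le_total b c with hbc | hcb
  · rw [hfirst b hab hbc, max_eq_right, mul_zero]
    have h1 : min (b : ℝ) d ≤ b := min_le_left _ _
    have h2 : (c : ℝ) ≤ max (a : ℝ) c := le_max_right _ _
    have h3 : (b : ℝ) ≤ c := by exact_mod_cast hbc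
    linarith
  set e := min b d with he
  have hce : c ≤ e := le_min hcb hcd
  have heb : e ≤ b := min_le_left _ _
  have hed : e ≤ d := min_le_right _ _
  -- Both increments are cut at `c` and `e`; the product of the parts beyond `e` vanishes because
  -- `e` is `b` or `d`.
  have hdec : ∀ ω, Y ω * ((Z b ω - Z a ω) * (Z d ω - Z c ω)) =
      Y ω * ((Z c ω - Z a ω) * (Z d ω - Z c ω)) + (Y ω * (Z e ω - Z c ω) ^ 2 +
      (Y ω * ((Z e ω - Z c ω) * (Z d ω - Z e ω)) + Y ω * ((Z e ω - Z c ω) * (Z b ω - Z e ω)))) := by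
    intro ω
    have : (Z b ω - Z e ω) * (Z d ω - Z e ω) = 0 := by
      rcases min_choice b d with h | h <;> rw [he, h] <;> simp
    linear_combination Y ω * this
  have hmid : ∀ f, e ≤ f → ∫ ω, Y ω * ((Z e ω - Z c ω) * (Z f ω - Z e ω)) ∂P = 0 := by
    intro f hef
    have := hZ.integral_mul_sub hef (Y := fun ω => Y ω * (Z e ω - Z c ω))
      ((hY.mono (𝔽.mono hce) le_rfl).mul ((mZ le_rfl).sub (mZ hce)))
    simpa only [mul_assoc] using this
  have i1 := hZ.integrable_mul_sub_mul_sub hac hcd hYm hYb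
  have i2 := hZ.integrable_mul_sub_mul_sub hce hce hYm hYb
  have i3 := hZ.integrable_mul_sub_mul_sub hce hed hYm hYb
  have i4 := hZ.integrable_mul_sub_mul_sub hce heb hYm hYb
  simp only [← pow_two] at i2
  rw [integral_congr_ae (ae_of_all _ hdec), integral_add i1 (by exact i2.add (i3.add i4)),
    integral_add i2 (by exact i3.add i4), integral_add i3 i4, hfirst c hac le_rfl,
    hmid d hed, hmid b heb, hZ.integral_mul_sub_sq hce hY]
  have e1 : min (b : ℝ) (d : ℝ) = e := by rw [he]; push_cast; rfl
  have e2 : max (a : ℝ) c = c := max_eq_right (by exact_mod_cast hac)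
  rw [e1, e2, max_eq_left (sub_nonneg.2 (by exact_mod_cast hce))]
  ring

lemma integral_mul_sub_mul_mul_sub [IsProbabilityMeasure P] (hZ : IsBrownianFor P 𝔽 Z)
    {a b c d : ℝ≥0} (hab : a ≤ b) (hcd : c ≤ d) {ξ η : Ω → ℝ}
    (hξ : Measurable[𝔽 a] ξ) (hη : Measurable[𝔽 c] η) (hξb : ∃ C : ℝ, ∀ ω, |ξ ω| ≤ C)
    (hηb : ∃ C : ℝ, ∀ ω, |η ω| ≤ C) :
    ∫ ω, (ξ ω * (Z b ω - Z a ω)) * (η ω * (Z d ω - Z c ω)) ∂P =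
      ∫ ω, ξ ω * η ω * max (min (b : ℝ) d - max (a : ℝ) c) 0 ∂P := by
  rw [integral_mul_const]
  -- The overlap is symmetric in the two intervals, and for `a ≤ c` the product `ξ * η` is known at
  -- time `c`.
  wlog hac : a ≤ c generalizing a b c d ξ η
  · have := this hcd hab hη hξ hηb hξb (le_of_not_ge hac)
    rw [min_comm, max_comm (a : ℝ)]
    simp only [mul_comm (ξ _) (η _)]
    rw [← this]
    congr 1; ext ω; ring
  · have hb : ∃ C : ℝ, ∀ ω, |ξ ω * η ω| ≤ C := by
      obtain ⟨C, hC⟩ := hξb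
      obtain ⟨C', hC'⟩ := hηb
      refine ⟨C * C', fun ω => ?_⟩
      rw [abs_mul]
      exact mul_le_mul (hC ω) (hC' ω) (abs_nonneg _) ((abs_nonneg _).trans (hC ω))
    rw [← hZ.integral_mul_sub_mul_sub_of_le hab hcd hac (Y := fun ω => ξ ω * η ω)
      ((hξ.mono (𝔽.mono hac) le_rfl).mul hη) hb]
    congr 1; ext ω; ring

variable {ι : Type*}

/-- The Itô isometry for simple integrands. -/
lemma lintegral_sum_mul_sub_sq [IsProbabilityMeasure P] (hZ : IsBrownianFor P 𝔽 Z)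
    (K : Finset ι) {a b : ι → ℝ≥0} (hab : ∀ k, a k ≤ b k) {ξ : ι → Ω → ℝ}
    (hξ : ∀ k, Measurable[𝔽 (a k)] (ξ k)) (hξb : ∀ k, ∃ C : ℝ, ∀ ω, |ξ k ω| ≤ C) :
    ∫⁻ ω, ‖∑ k ∈ K, ξ k ω * (Z (b k) ω - Z (a k) ω)‖ₑ ^ 2 ∂P =
      ∫⁻ ω, (∫⁻ s : ℝ,
        ‖∑ k ∈ K, (Set.Ioc (a k : ℝ) (b k)).indicator (fun _ => ξ k ω) s‖ₑ ^ 2) ∂P := by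
  have hξm : ∀ k, Measurable (ξ k) := fun k => (hξ k).mono (𝔽.le _) le_rfl
  -- Both sides of the isometry expand to the expectation of one quadratic form in the `ξ k`, whose
  -- coefficients are the overlap lengths.
  set ov : ι → ι → ℝ := fun k l => max (min (b k : ℝ) (b l) - max (a k : ℝ) (a l)) 0 with hov
  set Q : Ω → ℝ := fun ω => ∑ k ∈ K, ∑ l ∈ K, ξ k ω * ξ l ω * ov k l with hQ
  have henorm : ∀ x : ℝ, ‖x‖ₑ ^ 2 = ENNReal.ofReal (x ^ 2) := fun x => by
    rw [Real.enorm_eq_ofReal_abs, ← ENNReal.ofReal_pow (abs_nonneg x), sq_abs]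
  have hLp : ∀ k, MemLp (fun ω => ξ k ω * (Z (b k) ω - Z (a k) ω)) 2 P := fun k => by
    obtain ⟨C, hC⟩ := hξb k
    exact (hZ.memLp_sub (hab k)).mul (MemLp.of_bound (hξm k).aestronglyMeasurable C
      (ae_of_all _ hC)) (p := ∞)
  have hQint : ∀ k l, Integrable (fun ω => ξ k ω * ξ l ω * ov k l) P := fun k l => by
    obtain ⟨C, hC⟩ := hξb k
    obtain ⟨C', hC'⟩ := hξb l
    refine Integrable.mul_const ?_ _
    refine Integrable.of_bound ((hξm k).mul (hξm l)).aestronglyMeasurable (C * C')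
      (ae_of_all _ fun ω => ?_)
    rw [Real.norm_eq_abs, abs_mul]
    exact mul_le_mul (hC ω) (hC' ω) (abs_nonneg _) ((abs_nonneg _).trans (hC ω))
  have hi : ∀ ω k l, Integrable (fun s : ℝ =>
      (Set.Ioc (a k : ℝ) (b k)).indicator (fun _ => ξ k ω) s *
      (Set.Ioc (a l : ℝ) (b l)).indicator (fun _ => ξ l ω) s) := by
    intro ω k l
    simp_rw [← Set.inter_indicator_mul, Set.Ioc_inter_Ioc]
    exact (integrable_indicator_iff measurableSet_Ioc).2 (integrableOn_const (by simp) enorm_ne_top)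
  have hi' : ∀ ω, Integrable (fun s : ℝ =>
      (∑ k ∈ K, (Set.Ioc (a k : ℝ) (b k)).indicator (fun _ => ξ k ω) s) ^ 2) := by
    intro ω
    simp_rw [pow_two, Finset.sum_mul_sum]
    exact integrable_finsetSum _ fun k _ => integrable_finsetSum _ fun l _ => hi ω k l
  have hQeq : ∀ ω, Q ω =
      ∫ s : ℝ, (∑ k ∈ K, (Set.Ioc (a k : ℝ) (b k)).indicator (fun _ => ξ k ω) s) ^ 2 := by
    intro ω
    simp_rw [pow_two, Finset.sum_mul_sum]
    rw [integral_finsetSum _ fun k _ => integrable_finsetSum _ fun l _ => hi ω k l]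
    refine Finset.sum_congr rfl fun k _ => ?_
    rw [integral_finsetSum _ fun l _ => hi ω k l]
    refine Finset.sum_congr rfl fun l _ => ?_
    simp_rw [← Set.inter_indicator_mul, Set.Ioc_inter_Ioc]
    rw [integral_indicator measurableSet_Ioc, setIntegral_const, smul_eq_mul, mul_comm]
    simp [hov, Measure.real, Real.volume_Ioc, ENNReal.toReal_ofReal']
  have hinner : ∀ ω, ∫⁻ s : ℝ,
      ‖∑ k ∈ K, (Set.Ioc (a k : ℝ) (b k)).indicator (fun _ => ξ k ω) s‖ₑ ^ 2 =
        ENNReal.ofReal (Q ω) := by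
    intro ω
    simp only [henorm]
    rw [← ofReal_integral_eq_lintegral_ofReal (hi' ω) (ae_of_all _ fun s => sq_nonneg _), hQeq]
  have hQnonneg : ∀ ω, 0 ≤ Q ω := fun ω => by
    rw [hQeq]
    exact integral_nonneg fun s => sq_nonneg _
  simp only [hinner]
  simp only [henorm]
  rw [← ofReal_integral_eq_lintegral_ofReal (integrable_finsetSum _ fun k _ =>
      integrable_finsetSum _ fun l _ => hQint k l) (ae_of_all _ hQnonneg),
    ← ofReal_integral_eq_lintegral_ofReal (memLp_finsetSum K fun k _ => hLp k).integrable_sq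
      (ae_of_all _ fun ω => sq_nonneg _)]
  congr 1
  simp_rw [pow_two, Finset.sum_mul_sum]
  have hpi : ∀ k l, Integrable (fun ω => ξ k ω * (Z (b k) ω - Z (a k) ω) *
      (ξ l ω * (Z (b l) ω - Z (a l) ω))) P := fun k l => (hLp k).integrable_mul (hLp l)
  rw [integral_finsetSum _ fun k _ => integrable_finsetSum _ fun l _ => hpi k l,
    integral_finsetSum _ fun k _ => integrable_finsetSum _ fun l _ => hQint k l]
  refine Finset.sum_congr rfl fun k _ => ?_
  rw [integral_finsetSum _ fun l _ => hpi k l, integral_finsetSum _ fun l _ => hQint k l]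
  exact Finset.sum_congr rfl fun l _ =>
    hZ.integral_mul_sub_mul_mul_sub (hab k) (hab l) (hξ k) (hξ l) (hξb k) (hξb l)

end IsBrownianFor

end CARAGame

/-! ### Comparison of integrals of simple processes. -/

namespace CARAGame

namespace IsBrownianFor

variable {Ω : Type*} {mΩ : MeasurableSpace Ω} {P : Measure Ω}
  {𝔽 : Filtration ℝ≥0 mΩ} {Z : ℝ≥0 → Ω → ℝ} {t₀ T : ℝ}

/-- The isometry allows overlapping intervals, so no common refinement is needed: the difference is
one sum over the disjoint union of the two grids, with the second family of coefficients negated.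
Equality becomes an inequality because the right side integrates beyond `t`. -/
lemma lintegral_integral_sub_integral_sq [IsProbabilityMeasure P] (hZ : IsBrownianFor P 𝔽 Z)
    (ht₀ : 0 ≤ t₀) (S S' : SimpleProcess 𝔽 t₀ T) {t : ℝ} (ht : t ∈ Set.Icc t₀ T) :
    ∫⁻ ω, ‖S.integral Z t ω - S'.integral Z t ω‖ₑ ^ 2 ∂P ≤
      ∫⁻ ω, (∫⁻ s in Set.Icc t₀ T, ‖S.value s ω - S'.value s ω‖ₑ ^ 2) ∂P := by
  classical
  set g : ℕ ⊕ ℕ → ℝ := Sum.elim S.grid S'.grid with hg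
  set g' : ℕ ⊕ ℕ → ℝ := Sum.elim (fun k => S.grid (k + 1)) (fun k => S'.grid (k + 1)) with hg'
  set ζ : ℕ ⊕ ℕ → Ω → ℝ := Sum.elim S.ξ (fun k => -S'.ξ k) with hζ
  -- Intervals starting after `t` have zero increment. Their coefficient is replaced by `0`, since
  -- `ζ k` need not be known at time `min (g k) t = t`.
  set ξ : ℕ ⊕ ℕ → Ω → ℝ := fun k ω => if g k ≤ t then ζ k ω else 0 with hξ
  set K : Finset (ℕ ⊕ ℕ) := (Finset.range S.N).disjSum (Finset.range S'.N) with hK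
  have hgg' : ∀ k, g k ≤ g' k := by
    rintro (k | k)
    · exact S.grid_mono (Nat.le_succ k)
    · exact S'.grid_mono (Nat.le_succ k)
  have hgm : ∀ k, t₀ ≤ g k := by
    rintro (k | k)
    · exact (S.grid_mem k).1
    · exact (S'.grid_mem k).1
  have hζm : ∀ k, Measurable[𝔽 (g k).toNNReal] (ζ k) := by
    rintro (k | k)
    · exact S.ξ_meas k
    · exact (S'.ξ_meas k).neg
  have hζb : ∀ k, ∃ C : ℝ, ∀ ω, |ζ k ω| ≤ C := by
    rintro (k | k)
    · exact S.ξ_bdd k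
    · obtain ⟨C, hC⟩ := S'.ξ_bdd k
      exact ⟨C, fun ω => by simpa [hζ] using hC ω⟩
  have hξm : ∀ k, Measurable[𝔽 (min (g k) t).toNNReal] (ξ k) := by
    intro k
    by_cases h : g k ≤ t
    · rw [min_eq_left h]
      simp only [hξ, h, if_true]
      exact hζm k
    · simp only [hξ, h, if_false]
      exact measurable_const
  have hξb : ∀ k, ∃ C : ℝ, ∀ ω, |ξ k ω| ≤ C := by
    intro k
    obtain ⟨C, hC⟩ := hζb k
    refine ⟨C, fun ω => ?_⟩
    by_cases h : g k ≤ t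
    · simpa only [hξ, h, if_true] using hC ω
    · simpa only [hξ, h, if_false, abs_zero] using (abs_nonneg _).trans (hC ω)
  have key := hZ.lintegral_sum_mul_sub_sq K (a := fun k => (min (g k) t).toNNReal)
    (b := fun k => (min (g' k) t).toNNReal)
    (fun k => Real.toNNReal_le_toNNReal (min_le_min_right _ (hgg' k))) hξm hξb
  have hterm : ∀ k ω, ξ k ω * (Z (min (g' k) t).toNNReal ω - Z (min (g k) t).toNNReal ω) =
      ζ k ω * (Z (min (g' k) t).toNNReal ω - Z (min (g k) t).toNNReal ω) := by
    intro k ω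
    by_cases h : g k ≤ t
    · simp only [hξ, h, if_true]
    · have h' : t ≤ g k := le_of_not_ge h
      simp [min_eq_right h', min_eq_right (h'.trans (hgg' k))]
  have hleft : ∀ ω, S.integral Z t ω - S'.integral Z t ω =
      ∑ k ∈ K, ξ k ω * (Z (min (g' k) t).toNNReal ω - Z (min (g k) t).toNNReal ω) := by
    intro ω
    rw [Finset.sum_congr rfl fun k _ => hterm k ω]
    simp only [hK, Finset.sum_disjSum, SimpleProcess.integral, hζ, hg, hg', Sum.elim_inl,
      Sum.elim_inr, Pi.neg_apply, neg_mul, Finset.sum_neg_distrib, sub_eq_add_neg]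
  have hright : ∀ (s : ℝ) ω, ‖∑ k ∈ K, (Set.Ioc ((min (g k) t).toNNReal : ℝ)
      ((min (g' k) t).toNNReal)).indicator (fun _ => ξ k ω) s‖ₑ ^ 2 ≤
        (Set.Icc t₀ T).indicator (fun s => ‖S.value s ω - S'.value s ω‖ₑ ^ 2) s := by
    intro s ω
    have hc : ∀ k, ((min (g k) t).toNNReal : ℝ) = min (g k) t := fun k =>
      Real.coe_toNNReal _ (le_min (ht₀.trans (hgm k)) (ht₀.trans ht.1))
    have hc' : ∀ k, ((min (g' k) t).toNNReal : ℝ) = min (g' k) t := fun k =>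
      Real.coe_toNNReal _ (le_min (ht₀.trans ((hgm k).trans (hgg' k))) (ht₀.trans ht.1))
    simp only [hc, hc']
    by_cases hs : s ∈ Set.Icc t₀ t
    · rw [Set.indicator_of_mem (Set.Icc_subset_Icc_right ht.2 hs)]
      have : ∑ k ∈ K, (Set.Ioc (min (g k) t) (min (g' k) t)).indicator (fun _ => ξ k ω) s =
          S.value s ω - S'.value s ω := by
        have h1 : ∀ k, (Set.Ioc (min (g k) t) (min (g' k) t)).indicator (fun _ => ξ k ω) s =
            (Set.Ioc (g k) (g' k)).indicator (fun _ => ζ k ω) s := by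
          intro k
          by_cases h : g k < s
          · have hgt : g k ≤ t := h.le.trans hs.2
            simp only [Set.indicator, Set.mem_Ioc, min_eq_left hgt, h, true_and, le_min_iff, hs.2,
              and_true, hξ, hgt, if_true]
          · have h2 : ¬ min (g k) t < s := by
              rw [min_lt_iff]; push Not; exact ⟨not_lt.1 h, hs.2⟩
            simp only [Set.indicator, Set.mem_Ioc, h, h2, false_and, if_false]
        rw [Finset.sum_congr rfl fun k _ => h1 k]
        simp only [hK, Finset.sum_disjSum, SimpleProcess.value, hζ, hg, hg', Sum.elim_inl,
          Sum.elim_inr, Pi.neg_apply, Set.indicator_neg, Finset.sum_neg_distrib, sub_eq_add_neg]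
      rw [this]
    · rw [Finset.sum_eq_zero]
      · simp
      · intro k _
        refine Set.indicator_of_notMem (fun h => hs ⟨?_, ?_⟩) _
        · exact (le_min (hgm k) ht.1).trans h.1.le
        · exact h.2.trans (min_le_right _ _)
  simp only [hleft]
  rw [key]
  refine lintegral_mono fun ω => ?_
  rw [← lintegral_indicator measurableSet_Icc]
  exact lintegral_mono fun s => hright s ω

end IsBrownianFor

/-! ### Uniqueness of the Itô integral. -/

section Uniqueness

variable {Ω : Type*} {mΩ : MeasurableSpace Ω} {P : Measure Ω}
  {𝔽 : Filtration ℝ≥0 mΩ} {Z : ℝ≥0 → Ω → ℝ} {t₀ T : ℝ} {H I J : ℝ → Ω → ℝ}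

lemma enorm_sub_sq_le (a b c : ℝ) : ‖a - c‖ₑ ^ 2 ≤ 2 * ‖a - b‖ₑ ^ 2 + 2 * ‖c - b‖ₑ ^ 2 := by
  have henorm : ∀ x : ℝ, ‖x‖ₑ ^ 2 = ENNReal.ofReal (x ^ 2) := fun x => by
    rw [Real.enorm_eq_ofReal_abs, ← ENNReal.ofReal_pow (abs_nonneg x), sq_abs]
  rw [henorm, henorm, henorm, ← ENNReal.ofReal_ofNat 2, ← ENNReal.ofReal_mul (by norm_num),
    ← ENNReal.ofReal_mul (by norm_num), ← ENNReal.ofReal_add (by positivity) (by positivity)]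
  refine ENNReal.ofReal_le_ofReal ?_
  nlinarith [sq_nonneg ((a - b) + (c - b))]

lemma lintegral_enorm_sub_sq_le {α : Type*} {mα : MeasurableSpace α} (μ : Measure α)
    {u v w : α → ℝ} (hu : Measurable u) (hv : Measurable v) (hw : Measurable w) :
    ∫⁻ x, ‖u x - w x‖ₑ ^ 2 ∂μ ≤
      2 * ∫⁻ x, ‖u x - v x‖ₑ ^ 2 ∂μ + 2 * ∫⁻ x, ‖w x - v x‖ₑ ^ 2 ∂μ := by
  have m1 : Measurable fun x => ‖u x - v x‖ₑ ^ 2 := ((hu.sub hv).enorm).pow_const 2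
  have m2 : Measurable fun x => ‖w x - v x‖ₑ ^ 2 := ((hw.sub hv).enorm).pow_const 2
  rw [← lintegral_const_mul _ m1, ← lintegral_const_mul _ m2,
    ← lintegral_add_left (m1.const_mul _)]
  exact lintegral_mono fun x => enorm_sub_sq_le _ _ _

lemma SimpleProcess.measurable_integral (hZ : ∀ t, Measurable (Z t)) (S : SimpleProcess 𝔽 t₀ T)
    (t : ℝ) : Measurable (S.integral Z t) := by
  unfold SimpleProcess.integral
  exact Finset.measurable_fun_sum _ fun k _ =>
    ((S.ξ_meas k).mono (𝔽.le _) le_rfl).mul ((hZ _).sub (hZ _))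

lemma SimpleProcess.measurable_value (S : SimpleProcess 𝔽 t₀ T) :
    Measurable fun p : ℝ × Ω => S.value p.1 p.2 := by
  unfold SimpleProcess.value
  refine Finset.measurable_fun_sum _ fun k _ => ?_
  have : (fun p : ℝ × Ω => (Set.Ioc (S.grid k) (S.grid (k + 1))).indicator (fun _ => S.ξ k p.2) p.1)
      = (Prod.fst ⁻¹' Set.Ioc (S.grid k) (S.grid (k + 1))).indicator fun p => S.ξ k p.2 := by
    ext p; simp [Set.indicator]
  rw [this]
  exact (((S.ξ_meas k).mono (𝔽.le _) le_rfl).comp measurable_snd).indicator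
    (measurable_fst measurableSet_Ioc)

/-- Two approximating sequences both converge to `H`, hence approach each other in `ℍ²`, and by the
isometry so do their integrals in `L²`. Joint measurability of `H` turns the `ℍ²` distance into a
single integral over a product space. -/
lemma IsItoIntegral.ae_eq_at [IsProbabilityMeasure P] (hZ : IsBrownianFor P 𝔽 Z) (ht₀ : 0 ≤ t₀)
    (hH : Measurable fun p : ℝ × Ω => H p.1 p.2)
    (hI : IsItoIntegral P 𝔽 t₀ T Z H I) (hJ : IsItoIntegral P 𝔽 t₀ T Z H J) {t : ℝ}
    (ht : t ∈ Set.Icc t₀ T) : I t =ᵐ[P] J t := by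
  obtain ⟨-, hIc, S, hS, hSI⟩ := hI
  obtain ⟨-, hJc, S', hS', hSJ⟩ := hJ
  have hIm : Measurable (I t) := (hIc.1 t ht).mono (𝔽.le _) le_rfl
  have hJm : Measurable (J t) := (hJc.1 t ht).mono (𝔽.le _) le_rfl
  have mS : ∀ (S : SimpleProcess 𝔽 t₀ T), Measurable (S.integral Z t) := fun S =>
    S.measurable_integral hZ.measurable t
  -- the distance of the two approximations tends to zero
  have h1 : Tendsto (fun m => ∫⁻ ω, ‖(S m).integral Z t ω - (S' m).integral Z t ω‖ₑ ^ 2 ∂P)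
      atTop (𝓝 0) := by
    have hlim := ((ENNReal.Tendsto.const_mul (a := 2) hS (Or.inr (by simp))).add
      (ENNReal.Tendsto.const_mul (a := 2) hS' (Or.inr (by simp))))
    rw [mul_zero, add_zero] at hlim
    refine tendsto_of_tendsto_of_tendsto_of_le_of_le tendsto_const_nhds hlim
      (fun _ => zero_le) fun m => ?_
    refine (hZ.lintegral_integral_sub_integral_sq ht₀ (S m) (S' m) ht).trans ?_
    have e : ∀ {u v : ℝ × Ω → ℝ}, Measurable u → Measurable v →
        ∫⁻ ω, (∫⁻ s in Set.Icc t₀ T, ‖u (s, ω) - v (s, ω)‖ₑ ^ 2) ∂P =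
          ∫⁻ p, ‖u p - v p‖ₑ ^ 2 ∂((volume.restrict (Set.Icc t₀ T)).prod P) := fun hu hv =>
      (lintegral_prod_symm' _ (((hu.sub hv).enorm).pow_const 2)).symm
    rw [e (S m).measurable_value (S' m).measurable_value, e (S m).measurable_value hH,
      e (S' m).measurable_value hH]
    exact lintegral_enorm_sub_sq_le _ (S m).measurable_value hH (S' m).measurable_value
  have h2 : ∫⁻ ω, ‖I t ω - J t ω‖ₑ ^ 2 ∂P = 0 := by
    have hlim := (ENNReal.Tendsto.const_mul (a := 2) (hSI t ht) (Or.inr (by simp))).add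
      (ENNReal.Tendsto.const_mul (a := 2)
        ((ENNReal.Tendsto.const_mul (a := 2) (hSJ t ht) (Or.inr (by simp))).add
          (ENNReal.Tendsto.const_mul (a := 2) h1 (Or.inr (by simp)))) (Or.inr (by simp)))
    simp only [mul_zero, add_zero] at hlim
    refine le_antisymm (ge_of_tendsto' hlim fun m => ?_) zero_le
    refine (lintegral_enorm_sub_sq_le P hIm (mS (S m)) hJm).trans ?_
    simp only [enorm_sub_rev (I t _)]
    gcongr
    refine (lintegral_enorm_sub_sq_le P hJm (mS (S' m)) (mS (S m))).trans ?_
    simp only [enorm_sub_rev (J t _)]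
    exact le_rfl
  have hm : Measurable fun ω => ‖I t ω - J t ω‖ₑ ^ 2 := ((hIm.sub hJm).enorm).pow_const 2
  rw [lintegral_eq_zero_iff hm] at h2
  filter_upwards [h2] with ω hω
  simpa [sub_eq_zero] using hω

lemma IsItoIntegral.congr {H' : ℝ → Ω → ℝ} (h : ∀ s ∈ Set.Icc t₀ T, H s = H' s)
    (hI : IsItoIntegral P 𝔽 t₀ T Z H I) : IsItoIntegral P 𝔽 t₀ T Z H' I := by
  obtain ⟨⟨hp, hint_f⟩, hc, S, hS, hSI⟩ := hI
  refine ⟨⟨fun s hs => ?_, ?_⟩, hc, S, ?_, hSI⟩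
  · convert hp s hs using 2 with p
    rw [h p.1 ⟨p.1.2.1, p.1.2.2.trans hs.2⟩]
  · convert hint_f using 3 with ω
    exact setLIntegral_congr_fun measurableSet_Icc fun s hs => by simp only [h s hs]
  · convert hS using 4 with m ω
    exact setLIntegral_congr_fun measurableSet_Icc fun s hs => by simp only [h s hs]

/-- Two processes with continuous paths that agree almost surely at each time are
indistinguishable. -/
lemma ae_forall_eq_of_ae_eq {E : Type*} [TopologicalSpace E] [T2Space E] {X Y : ℝ → Ω → E}
    (hX : ∀ ω, ContinuousOn (fun t => X t ω) (Set.Icc t₀ T))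
    (hY : ∀ ω, ContinuousOn (fun t => Y t ω) (Set.Icc t₀ T))
    (h : ∀ t ∈ Set.Icc t₀ T, X t =ᵐ[P] Y t) :
    ∀ᵐ ω ∂P, ∀ t ∈ Set.Icc t₀ T, X t ω = Y t ω := by
  obtain ⟨D, hDc, hDd⟩ := TopologicalSpace.exists_countable_dense (Set.Icc t₀ T)
  have : ∀ᵐ ω ∂P, ∀ t ∈ D, X t ω = Y t ω := (ae_ball_iff hDc).2 fun t _ => h t t.2
  filter_upwards [this] with ω hω t ht
  exact congrFun (Continuous.ext_on hDd (continuousOn_iff_continuous_domRestrict.1 (hX ω))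
    (continuousOn_iff_continuous_domRestrict.1 (hY ω)) hω) ⟨t, ht⟩

lemma IsItoIntegral.ae_eq [IsProbabilityMeasure P] (hZ : IsBrownianFor P 𝔽 Z) (ht₀ : 0 ≤ t₀)
    (hH : Measurable fun p : ℝ × Ω => H p.1 p.2)
    (hI : IsItoIntegral P 𝔽 t₀ T Z H I) (hJ : IsItoIntegral P 𝔽 t₀ T Z H J) :
    ∀ᵐ ω ∂P, ∀ t ∈ Set.Icc t₀ T, I t ω = J t ω :=
  ae_forall_eq_of_ae_eq hI.2.1.2 hJ.2.1.2 fun _ ht => hI.ae_eq_at hZ ht₀ hH hJ ht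

end Uniqueness

end CARAGame

namespace CARAGame

/-! ### An exponential maximal inequality for sums of Brownian increments -/

namespace IsBrownianFor

variable {Ω : Type*} {mΩ : MeasurableSpace Ω} {P : Measure Ω}
  {𝔽 : Filtration ℝ≥0 mΩ} {Z : ℝ≥0 → Ω → ℝ}

/-- The sum of the first `k` increments of `Z` along the times `u`, with weights `c`. -/
def incrementSum (Z : ℝ≥0 → Ω → ℝ) (u : ℕ → ℝ≥0) (c : ℕ → ℝ) (k : ℕ) (ω : Ω) : ℝ :=
  ∑ i ∈ Finset.range k, c i * (Z (u (i + 1)) ω - Z (u i) ω)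

lemma incrementSum_succ (Z : ℝ≥0 → Ω → ℝ) (u : ℕ → ℝ≥0) (c : ℕ → ℝ) (k : ℕ) (ω : Ω) :
    incrementSum Z u c (k + 1) ω = incrementSum Z u c k ω + c k * (Z (u (k + 1)) ω - Z (u k) ω) :=
  Finset.sum_range_succ _ _

lemma measurable_incrementSum (hZ : IsBrownianFor P 𝔽 Z) {u : ℕ → ℝ≥0} (hu : Monotone u)
    (c : ℕ → ℝ) (k : ℕ) : Measurable[𝔽 (u k)] (incrementSum Z u c k) := by
  have mZ : ∀ i, i ≤ k → Measurable[𝔽 (u k)] (Z (u i)) := fun i hi =>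
    (hZ.adapted _).mono (𝔽.mono (hu hi)) le_rfl
  refine Finset.measurable_fun_sum _ fun i hi => ?_
  have hi' := Finset.mem_range.1 hi
  exact ((mZ (i + 1) hi').sub (mZ i hi'.le)).const_mul _

lemma integral_exp_mul [IsProbabilityMeasure P] (hZ : IsBrownianFor P 𝔽 Z) {s t : ℝ≥0}
    (hst : s ≤ t) (l : ℝ) {Y : Ω → ℝ} (hY : Measurable[𝔽 s] Y) (hYi : Integrable Y P) :
    Integrable (fun ω => Y ω * Real.exp (l * (Z t ω - Z s ω))) P ∧
      ∫ ω, Y ω * Real.exp (l * (Z t ω - Z s ω)) ∂P =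
        (∫ ω, Y ω ∂P) * Real.exp ((t - s) * l ^ 2 / 2) := by
  have hm : Measurable fun x : ℝ => Real.exp (l * x) := by fun_prop
  have hind := (hZ.indepFun hst hY).comp measurable_id hm
  refine ⟨hind.integrable_mul hYi (hZ.integrable_exp_sub hst l), ?_⟩
  rw [← hZ.integral_exp_sub hst l]
  exact hind.integral_mul_eq_mul_integral hYi.aestronglyMeasurable
    (hZ.integrable_exp_sub hst l).aestronglyMeasurable

/-- Given `𝔽 (u k)`, the next increment contributes an independent factor with mean `exp ((u (k + 1)
- u k) * (l * c k) ^ 2 / 2)`; these factors multiply up. -/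
lemma integral_exp_incrementSum [IsProbabilityMeasure P] (hZ : IsBrownianFor P 𝔽 Z)
    {u : ℕ → ℝ≥0} (hu : Monotone u) {c : ℕ → ℝ} {K : ℝ} (hc : ∀ k, |c k| ≤ K) (l : ℝ) (k : ℕ) :
    Integrable (fun ω => Real.exp (l * incrementSum Z u c k ω)) P ∧
      ∫ ω, Real.exp (l * incrementSum Z u c k ω) ∂P ≤
        Real.exp (l ^ 2 * K ^ 2 * (u k - u 0) / 2) := by
  induction k with
  | zero => simp [incrementSum]
  | succ k ih =>
    have hm : Measurable[𝔽 (u k)] fun ω => Real.exp (l * incrementSum Z u c k ω) :=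
      Real.measurable_exp.comp ((hZ.measurable_incrementSum hu c k).const_mul l)
    have h := hZ.integral_exp_mul (hu (Nat.le_succ k)) (l * c k) hm ih.1
    have e : ∀ ω, Real.exp (l * incrementSum Z u c (k + 1) ω) =
        Real.exp (l * incrementSum Z u c k ω) *
          Real.exp (l * c k * (Z (u (k + 1)) ω - Z (u k) ω)) := fun ω => by
      rw [← Real.exp_add, incrementSum_succ]; ring_nf
    simp only [e]
    refine ⟨h.1, h.2.le.trans ?_⟩
    calc _ ≤ Real.exp (l ^ 2 * K ^ 2 * (u k - u 0) / 2) *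
          Real.exp ((u (k + 1) - u k) * (l ^ 2 * K ^ 2) / 2) := by
          refine mul_le_mul ih.2 (Real.exp_le_exp.2 ?_) (Real.exp_pos _).le (Real.exp_pos _).le
          have h1 : (0 : ℝ) ≤ u (k + 1) - u k :=
            sub_nonneg.2 (NNReal.coe_le_coe.2 (hu (Nat.le_succ k)))
          have h2 : (l * c k) ^ 2 ≤ l ^ 2 * K ^ 2 := by
            rw [mul_pow]
            exact mul_le_mul_of_nonneg_left (sq_le_sq' (abs_le.1 (hc k)).1 (abs_le.1 (hc k)).2)
              (sq_nonneg l)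
          have := mul_le_mul_of_nonneg_left h2 h1
          exact div_le_div_of_nonneg_right this zero_le_two
      _ = _ := by rw [← Real.exp_add]; ring_nf

/-- Each new factor is independent of the past and has mean at least `1`. -/
lemma submartingale_exp_incrementSum [IsProbabilityMeasure P] (hZ : IsBrownianFor P 𝔽 Z)
    {u : ℕ → ℝ≥0} (hu : Monotone u) {c : ℕ → ℝ} {K : ℝ} (hc : ∀ k, |c k| ≤ K) (l : ℝ) :
    Submartingale (fun k ω => Real.exp (l * incrementSum Z u c k ω))
      (⟨fun k => 𝔽 (u k), fun _ _ h => 𝔽.mono (hu h), fun k => 𝔽.le (u k)⟩ : Filtration ℕ mΩ)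
      P := by
  have hm : ∀ k, Measurable[𝔽 (u k)] fun ω => Real.exp (l * incrementSum Z u c k ω) := fun k =>
      Real.measurable_exp.comp ((hZ.measurable_incrementSum hu c k).const_mul l)
  refine submartingale_of_setIntegral_le_succ (fun k => (hm k).stronglyMeasurable)
    (fun k => (hZ.integral_exp_incrementSum hu hc l k).1) fun k s hs => ?_
  have hs' : MeasurableSet s := 𝔽.le (u k) _ hs
  have hint_f := (hZ.integral_exp_incrementSum hu hc l k).1
  have h := hZ.integral_exp_mul (hu (Nat.le_succ k)) (l * c k) ((hm k).indicator hs)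
    (hint_f.indicator hs')
  have e : s.indicator (fun ω => Real.exp (l * incrementSum Z u c (k + 1) ω)) = fun ω =>
      s.indicator (fun ω => Real.exp (l * incrementSum Z u c k ω)) ω *
        Real.exp (l * c k * (Z (u (k + 1)) ω - Z (u k) ω)) := by
    ext ω
    by_cases hω : ω ∈ s
    · simp only [Set.indicator_of_mem hω]
      rw [← Real.exp_add, incrementSum_succ]; ring_nf
    · simp only [Set.indicator_of_notMem hω, zero_mul]
  rw [← integral_indicator hs', ← integral_indicator hs', e, h.2]
  refine le_mul_of_one_le_right (integral_nonneg fun ω =>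
    Set.indicator_nonneg (fun _ _ => (Real.exp_pos _).le) ω) (Real.one_le_exp ?_)
  have h1 : (0 : ℝ) ≤ u (k + 1) - u k :=
    sub_nonneg.2 (NNReal.coe_le_coe.2 (hu (Nat.le_succ k)))
  positivity

/-- Doob's maximal inequality for the exponential submartingale at level `exp (l * ε)`. The
parameter `l` stays free, to be chosen according to the use. -/
lemma measure_exists_le_incrementSum [IsProbabilityMeasure P] (hZ : IsBrownianFor P 𝔽 Z)
    {u : ℕ → ℝ≥0} (hu : Monotone u) {c : ℕ → ℝ} {K : ℝ} (hc : ∀ k, |c k| ≤ K) {l : ℝ} (hl : 0 ≤ l)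
    (ε : ℝ) (N : ℕ) :
    P {ω | ∃ k ≤ N, ε ≤ incrementSum Z u c k ω} ≤
      ENNReal.ofReal (Real.exp (-(l * ε) + l ^ 2 * K ^ 2 * (u N - u 0) / 2)) := by
  have hsub := hZ.submartingale_exp_incrementSum hu hc l
  have hmax := maximal_ineq hsub (fun k ω => (Real.exp_pos _).le)
    (ε := (Real.exp (l * ε)).toNNReal) N
  rw [Real.coe_toNNReal _ (Real.exp_pos _).le] at hmax
  set A : Set Ω := {ω | Real.exp (l * ε) ≤
    (Finset.range (N + 1)).sup' Finset.nonempty_range_add_one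
      fun k => Real.exp (l * incrementSum Z u c k ω)} with hA
  have hsubset : {ω | ∃ k ≤ N, ε ≤ incrementSum Z u c k ω} ⊆ A := by
    rintro ω ⟨k, hk, hω⟩
    rw [hA, Set.mem_ofPred_eq, Finset.le_sup'_iff]
    exact ⟨k, Finset.mem_range.2 (Nat.lt_succ_of_le hk),
      Real.exp_le_exp.2 (mul_le_mul_of_nonneg_left hω hl)⟩
  have hint_f := hZ.integral_exp_incrementSum hu hc l N
  have h1 : ENNReal.ofReal (Real.exp (l * ε)) * P A ≤
      ENNReal.ofReal (Real.exp (l ^ 2 * K ^ 2 * (u N - u 0) / 2)) := by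
    refine hmax.trans (ENNReal.ofReal_le_ofReal (le_trans ?_ hint_f.2))
    exact setIntegral_le_integral hint_f.1 (ae_of_all _ fun ω => (Real.exp_pos _).le)
  calc P {ω | ∃ k ≤ N, ε ≤ incrementSum Z u c k ω} ≤ P A := measure_mono hsubset
    _ = ENNReal.ofReal (Real.exp (-(l * ε))) * (ENNReal.ofReal (Real.exp (l * ε)) * P A) := by
        rw [← mul_assoc, ← ENNReal.ofReal_mul (Real.exp_pos _).le, ← Real.exp_add]
        simp
    _ ≤ ENNReal.ofReal (Real.exp (-(l * ε))) *
        ENNReal.ofReal (Real.exp (l ^ 2 * K ^ 2 * (u N - u 0) / 2)) := by gcongr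
    _ = _ := by rw [← ENNReal.ofReal_mul (Real.exp_pos _).le, ← Real.exp_add]

lemma measure_exists_le_abs_incrementSum [IsProbabilityMeasure P] (hZ : IsBrownianFor P 𝔽 Z)
    {u : ℕ → ℝ≥0} (hu : Monotone u) {c : ℕ → ℝ} {K : ℝ} (hc : ∀ k, |c k| ≤ K) {l : ℝ} (hl : 0 ≤ l)
    (ε : ℝ) (N : ℕ) :
    P {ω | ∃ k ≤ N, ε ≤ |incrementSum Z u c k ω|} ≤
      ENNReal.ofReal (2 * Real.exp (-(l * ε) + l ^ 2 * K ^ 2 * (u N - u 0) / 2)) := by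
  have h1 := hZ.measure_exists_le_incrementSum hu hc hl ε N
  have h2 := hZ.measure_exists_le_incrementSum hu (c := fun k => -c k) (K := K)
    (fun k => by simpa using hc k) hl ε N
  have hneg : ∀ k ω, incrementSum Z u (fun k => -c k) k ω = -incrementSum Z u c k ω := by
    intro k ω; simp [incrementSum]
  rw [two_mul, ENNReal.ofReal_add (Real.exp_pos _).le (Real.exp_pos _).le]
  refine le_trans (measure_mono ?_) ((measure_union_le _ _).trans (add_le_add h1 h2))
  rintro ω ⟨k, hk, hω⟩
  rcases le_abs.1 hω with h | h
  · exact Or.inl ⟨k, hk, h⟩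
  · exact Or.inr ⟨k, hk, by rw [hneg]; exact h⟩

end IsBrownianFor

end CARAGame

namespace CARAGame

/-! ### Deterministic integrands that are constant on dyadic intervals -/

/-- The dyadic points `t₀ + k (T - t₀) / 2 ^ m` of `[t₀, T]`. -/
noncomputable def dyadicGrid (t₀ T : ℝ) (m k : ℕ) : ℝ := min (t₀ + k * ((T - t₀) / 2 ^ m)) T

section Grid

variable {t₀ T : ℝ}

lemma dyadicGrid_mono (h : t₀ ≤ T) (m : ℕ) : Monotone (dyadicGrid t₀ T m) := by
  intro i j hij
  have h1 : (i : ℝ) ≤ j := by exact_mod_cast hij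
  have h2 : 0 ≤ (T - t₀) / 2 ^ m := div_nonneg (sub_nonneg.2 h) (by positivity)
  exact min_le_min_right _ (by gcongr)

lemma dyadicGrid_mem (h : t₀ ≤ T) (m k : ℕ) : dyadicGrid t₀ T m k ∈ Set.Icc t₀ T := by
  refine ⟨le_min ?_ h, min_le_right _ _⟩
  have h2 : 0 ≤ (T - t₀) / 2 ^ m := div_nonneg (sub_nonneg.2 h) (by positivity)
  have : 0 ≤ (k : ℝ) * ((T - t₀) / 2 ^ m) := by positivity
  linarith

lemma dyadicGrid_zero (h : t₀ ≤ T) (m : ℕ) : dyadicGrid t₀ T m 0 = t₀ := by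
  simp [dyadicGrid, h]

lemma dyadicGrid_two_pow (m : ℕ) : dyadicGrid t₀ T m (2 ^ m) = T := by
  have : ((2 ^ m : ℕ) : ℝ) * ((T - t₀) / 2 ^ m) = T - t₀ := by push_cast; field_simp
  unfold dyadicGrid
  rw [this]
  simp

lemma dyadicGrid_add_mul (m r k : ℕ) :
    dyadicGrid t₀ T (m + r) (k * 2 ^ r) = dyadicGrid t₀ T m k := by
  have : ((k * 2 ^ r : ℕ) : ℝ) * ((T - t₀) / 2 ^ (m + r)) = k * ((T - t₀) / 2 ^ m) := by
    push_cast; rw [pow_add]; field_simp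
  simp only [dyadicGrid, this]

lemma dyadicGrid_succ_le (h : t₀ ≤ T) (m k : ℕ) :
    dyadicGrid t₀ T m (k + 1) ≤ dyadicGrid t₀ T m k + (T - t₀) / 2 ^ m := by
  have h2 : 0 ≤ (T - t₀) / 2 ^ m := div_nonneg (sub_nonneg.2 h) (by positivity)
  unfold dyadicGrid
  rw [← min_add_add_right]
  push_cast
  exact min_le_min (by linarith) (by linarith)

/-- The natural division `k / 2 ^ r` is the index of the level-`m` interval starting at or before
the `k`-th point of level `m + r`. -/
lemma abs_dyadicGrid_div_sub_le (h : t₀ ≤ T) (m r k : ℕ) :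
    |dyadicGrid t₀ T m (k / 2 ^ r) - dyadicGrid t₀ T (m + r) k| ≤ (T - t₀) / 2 ^ m := by
  have h1 : dyadicGrid t₀ T m (k / 2 ^ r) ≤ dyadicGrid t₀ T (m + r) k := by
    rw [← dyadicGrid_add_mul m r]
    exact dyadicGrid_mono h _ (Nat.div_mul_le_self _ _)
  have h2 : dyadicGrid t₀ T (m + r) k ≤ dyadicGrid t₀ T m (k / 2 ^ r + 1) := by
    rw [← dyadicGrid_add_mul m r]
    refine dyadicGrid_mono h _ ?_
    exact (Nat.lt_mul_of_div_lt (Nat.lt_succ_self _) (by positivity)).le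
  have h3 := dyadicGrid_succ_le h m (k / 2 ^ r)
  rw [abs_sub_comm, abs_of_nonneg (sub_nonneg.2 h1)]
  linarith

end Grid

lemma sum_range_two_mul {M : Type*} [AddCommMonoid M] (F : ℕ → M) (N : ℕ) :
    ∑ k ∈ Finset.range (2 * N), F k = ∑ k ∈ Finset.range N, (F (2 * k) + F (2 * k + 1)) := by
  induction N with
  | zero => simp
  | succ N ih =>
    rw [Nat.mul_succ, Finset.sum_range_succ, Finset.sum_range_succ, ih, Finset.sum_range_succ,
      add_assoc]

lemma exists_mem_Ioc_of_monotone {g : ℕ → ℝ} {N : ℕ} {s : ℝ} (h0 : g 0 < s)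
    (hN : s ≤ g N) : ∃ k < N, s ∈ Set.Ioc (g k) (g (k + 1)) := by
  induction N with
  | zero => exact absurd hN (not_le.2 h0)
  | succ N ih =>
    by_cases h : s ≤ g N
    · obtain ⟨k, hk, hs⟩ := ih h
      exact ⟨k, hk.trans (Nat.lt_succ_self N), hs⟩
    · exact ⟨N, Nat.lt_succ_self N, not_le.1 h, hN⟩

section Step

variable {Ω : Type*} {mΩ : MeasurableSpace Ω} (𝔽 : Filtration ℝ≥0 mΩ) {t₀ T : ℝ}

/-- The deterministic process with the value `c k` on the `k`-th dyadic interval of level `m`. -/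
noncomputable def dyadicProcess (h : t₀ ≤ T) (m : ℕ) (c : ℕ → ℝ) : SimpleProcess 𝔽 t₀ T where
  N := 2 ^ m
  grid := dyadicGrid t₀ T m
  grid_mono := dyadicGrid_mono h m
  grid_mem := dyadicGrid_mem h m
  ξ k _ := c k
  ξ_meas _ := measurable_const
  ξ_bdd k := ⟨|c k|, fun _ => le_rfl⟩

variable {𝔽} (h : t₀ ≤ T) (Z : ℝ≥0 → Ω → ℝ)

/-- The intervals are open on the left, so `t₀` lies in none of them; this is why value estimates
are stated on `Set.Ioc t₀ T`. -/
lemma dyadicProcess_value (m : ℕ) (c : ℕ → ℝ) {s : ℝ} (hs : s ∈ Set.Ioc t₀ T) (ω : Ω) :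
    ∃ k, s ∈ Set.Ioc (dyadicGrid t₀ T m k) (dyadicGrid t₀ T m (k + 1)) ∧
      (dyadicProcess 𝔽 h m c).value s ω = c k := by
  obtain ⟨k, hk, hsk⟩ := exists_mem_Ioc_of_monotone (g := dyadicGrid t₀ T m) (N := 2 ^ m) (s := s)
    (by rw [dyadicGrid_zero h]; exact hs.1) (by rw [dyadicGrid_two_pow]; exact hs.2)
  refine ⟨k, hsk, ?_⟩
  simp only [SimpleProcess.value, dyadicProcess]
  rw [Finset.sum_eq_single_of_mem k (Finset.mem_range.2 hk)]
  · exact Set.indicator_of_mem hsk _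
  · intro i _ hik
    refine Set.indicator_of_notMem (fun hi => ?_) _
    rcases lt_or_gt_of_ne hik with h' | h'
    · exact absurd (hi.2.trans (dyadicGrid_mono h m h')) (not_le.2 hsk.1)
    · exact absurd (hsk.2.trans (dyadicGrid_mono h m h')) (not_le.2 hi.1)

lemma dyadicProcess_integral_succ (m : ℕ) (c : ℕ → ℝ) (t : ℝ) (ω : Ω) :
    (dyadicProcess 𝔽 h m c).integral Z t ω =
      (dyadicProcess 𝔽 h (m + 1) fun k => c (k / 2)).integral Z t ω := by
  simp only [SimpleProcess.integral, dyadicProcess]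
  rw [pow_succ, mul_comm (2 ^ m) 2, sum_range_two_mul]
  refine Finset.sum_congr rfl fun k _ => ?_
  have e1 : dyadicGrid t₀ T (m + 1) (2 * k) = dyadicGrid t₀ T m k := by
    rw [← dyadicGrid_add_mul m 1 k]; ring_nf
  have e2 : dyadicGrid t₀ T (m + 1) (2 * k + 1 + 1) = dyadicGrid t₀ T m (k + 1) := by
    rw [← dyadicGrid_add_mul m 1 (k + 1)]; ring_nf
  have e3 : (2 * k) / 2 = k := by omega
  have e4 : (2 * k + 1) / 2 = k := by omega
  rw [e1, e2, e3, e4]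
  ring

/-- Refining the grid leaves the integral unchanged, so processes of different levels can be
subtracted term by term on the finer one. -/
lemma dyadicProcess_integral_add (m r : ℕ) (c : ℕ → ℝ) (t : ℝ) (ω : Ω) :
    (dyadicProcess 𝔽 h m c).integral Z t ω =
      (dyadicProcess 𝔽 h (m + r) fun k => c (k / 2 ^ r)).integral Z t ω := by
  induction r with
  | zero => simp
  | succ r ih =>
    rw [ih, dyadicProcess_integral_succ, ← add_assoc]
    congr 2
    ext k
    rw [Nat.div_div_eq_div_mul, pow_succ, mul_comm 2]

lemma dyadicProcess_integral_sub (m : ℕ) (c d : ℕ → ℝ) (t : ℝ) (ω : Ω) :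
    (dyadicProcess 𝔽 h m c).integral Z t ω - (dyadicProcess 𝔽 h m d).integral Z t ω =
      (dyadicProcess 𝔽 h m fun k => c k - d k).integral Z t ω := by
  simp only [SimpleProcess.integral, dyadicProcess, ← Finset.sum_sub_distrib, sub_mul]

lemma dyadicProcess_integral_grid (m : ℕ) (c : ℕ → ℝ) {j : ℕ} (hj : j ≤ 2 ^ m) (ω : Ω) :
    (dyadicProcess 𝔽 h m c).integral Z (dyadicGrid t₀ T m j) ω =
      IsBrownianFor.incrementSum Z (fun k => (dyadicGrid t₀ T m k).toNNReal) c j ω := by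
  simp only [SimpleProcess.integral, dyadicProcess, IsBrownianFor.incrementSum]
  symm
  rw [← Finset.sum_subset (Finset.range_subset_range.2 hj)]
  · refine Finset.sum_congr rfl fun k hk => ?_
    have hk' := Finset.mem_range.1 hk
    rw [min_eq_left (dyadicGrid_mono h m hk'), min_eq_left (dyadicGrid_mono h m hk'.le)]
  · intro k _ hk
    have hk' : j ≤ k := by simpa using hk
    rw [min_eq_right (dyadicGrid_mono h m hk'),
      min_eq_right (dyadicGrid_mono h m (hk'.trans (Nat.le_succ k))), sub_self, mul_zero]

variable {Z}

lemma SimpleProcess.continuous_integral (S : SimpleProcess 𝔽 t₀ T) {ω : Ω}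
    (hω : Continuous (Z · ω)) : Continuous fun t => S.integral Z t ω := by
  unfold SimpleProcess.integral
  fun_prop

lemma dense_dyadicGrid (h : t₀ < T) (m : ℕ) {t : ℝ} (ht : t ∈ Set.Icc t₀ T) :
    ∃ j : ℕ → ℕ, (∀ r, j r ≤ 2 ^ (m + r)) ∧
      Tendsto (fun r => dyadicGrid t₀ T (m + r) (j r)) atTop (𝓝 t) := by
  have hex : ∀ r, ∃ j ≤ 2 ^ (m + r), |dyadicGrid t₀ T (m + r) j - t| ≤ (T - t₀) * (1 / 2) ^ r := by
    intro r
    have hle : (T - t₀) / 2 ^ (m + r) ≤ (T - t₀) * (1 / 2) ^ r := by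
      rw [div_eq_mul_inv, one_div, inv_pow]
      refine mul_le_mul_of_nonneg_left (inv_anti₀ (by positivity) ?_) (sub_nonneg.2 h.le)
      exact pow_le_pow_right₀ one_le_two (Nat.le_add_left r m)
    rcases eq_or_lt_of_le ht.1 with rfl | h0
    · refine ⟨0, zero_le, ?_⟩
      rw [dyadicGrid_zero h.le, sub_self, abs_zero]
      have := sub_nonneg.2 h.le
      positivity
    · obtain ⟨k, hk, hsk⟩ := exists_mem_Ioc_of_monotone (g := dyadicGrid t₀ T (m + r))
        (N := 2 ^ (m + r)) (s := t)
        (by rw [dyadicGrid_zero h.le]; exact h0) (by rw [dyadicGrid_two_pow]; exact ht.2)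
      refine ⟨k, hk.le, le_trans ?_ hle⟩
      have := dyadicGrid_succ_le h.le (m + r) k
      rw [abs_sub_comm, abs_of_nonneg (sub_nonneg.2 hsk.1.le)]
      linarith [hsk.2]
  choose j hj hjt using hex
  refine ⟨j, hj, ?_⟩
  rw [tendsto_iff_dist_tendsto_zero]
  refine squeeze_zero (g := fun r => (T - t₀) * (1 / 2) ^ r) (fun _ => dist_nonneg)
    (fun r => by rw [Real.dist_eq]; exact hjt r) ?_
  have := (tendsto_pow_atTop_nhds_zero_of_lt_one (r := (1 / 2 : ℝ)) (by norm_num)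
    (by norm_num)).const_mul (T - t₀)
  simpa using this

/-- Gaussian tail bound for the maximum of the integral of a dyadic process. -/
lemma IsBrownianFor.measure_exists_lt_abs_dyadic {P : Measure Ω} [IsProbabilityMeasure P]
    (hZ : IsBrownianFor P 𝔽 Z) (ht₀ : 0 ≤ t₀) (h : t₀ < T) (m : ℕ) {c : ℕ → ℝ} {K : ℝ}
    (hc : ∀ k, |c k| ≤ K) {l : ℝ} (hl : 0 ≤ l) (ε : ℝ) :
    P {ω | ∃ t ∈ Set.Icc t₀ T, ε < |(dyadicProcess 𝔽 h.le m c).integral Z t ω|} ≤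
      ENNReal.ofReal (2 * Real.exp (-(l * ε) + l ^ 2 * K ^ 2 * (T - t₀) / 2)) := by
  set J := (dyadicProcess 𝔽 h.le m c).integral Z with hJ
  -- Refinement changes neither the bound `K` on the weights nor the total time, so all `A r` share
  -- one estimate. They increase with `r`, and by continuity of paths their union contains every
  -- strict exceedance at any time.
  set A : ℕ → Set Ω := fun r => {ω | ∃ j ≤ 2 ^ (m + r), ε ≤ |J (dyadicGrid t₀ T (m + r) j) ω|}
    with hA
  have hAmono : Monotone A := by
    refine monotone_nat_of_le_succ fun r ω => ?_
    rintro ⟨j, hj, hω⟩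
    refine ⟨j * 2 ^ 1, ?_, ?_⟩
    · rw [← add_assoc, pow_succ]; omega
    · rw [← add_assoc, dyadicGrid_add_mul]; exact hω
  have hAle : ∀ r, P (A r) ≤
      ENNReal.ofReal (2 * Real.exp (-(l * ε) + l ^ 2 * K ^ 2 * (T - t₀) / 2)) := by
    intro r
    set u : ℕ → ℝ≥0 := fun k => (dyadicGrid t₀ T (m + r) k).toNNReal with hu
    have hum : Monotone u := fun i j hij =>
      Real.toNNReal_le_toNNReal (dyadicGrid_mono h.le _ hij)
    have hmax := hZ.measure_exists_le_abs_incrementSum hum (c := fun k => c (k / 2 ^ r))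
      (fun k => hc _) hl ε (2 ^ (m + r))
    have e1 : (u (2 ^ (m + r)) : ℝ) = T := by
      rw [hu]; simp only
      rw [dyadicGrid_two_pow, Real.coe_toNNReal _ (ht₀.trans h.le)]
    have e2 : (u 0 : ℝ) = t₀ := by
      rw [hu]; simp only
      rw [dyadicGrid_zero h.le, Real.coe_toNNReal _ ht₀]
    rw [e1, e2] at hmax
    refine le_trans (measure_mono ?_) hmax
    rintro ω ⟨j, hj, hω⟩
    refine ⟨j, hj, ?_⟩
    rw [hJ, dyadicProcess_integral_add h.le Z m r, dyadicProcess_integral_grid h.le Z _ _ hj] at hω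
    exact hω
  have hsub : {ω | ∃ t ∈ Set.Icc t₀ T, ε < |J t ω|} ≤ᵐ[P] ⋃ r, A r := by
    filter_upwards [hZ.cont] with ω hω
    rintro ⟨t, ht, hε⟩
    obtain ⟨j, hj, hjt⟩ := dense_dyadicGrid h m ht
    have hlim : Tendsto (fun r => |J (dyadicGrid t₀ T (m + r) (j r)) ω|) atTop (𝓝 |J t ω|) :=
      (((SimpleProcess.continuous_integral _ hω).tendsto t).comp hjt).abs
    obtain ⟨r, hr⟩ := (hlim.eventually (lt_mem_nhds hε)).exists
    exact Set.mem_iUnion.2 ⟨r, j r, hj r, hr.le⟩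
  refine (measure_mono_ae hsub).trans ?_
  rw [hAmono.measure_iUnion]
  exact iSup_le hAle

end Step

end CARAGame

namespace CARAGame

/-! ### Existence of the Wiener integral -/

section

variable {Ω : Type*} {mΩ : MeasurableSpace Ω} {P : Measure Ω}
  {𝔽 : Filtration ℝ≥0 mΩ} {Z : ℝ≥0 → Ω → ℝ} {t₀ T : ℝ}

lemma IsContinuousAdapted.isProgressiveOn {E : Type*} [TopologicalSpace E]
    [TopologicalSpace.PseudoMetrizableSpace E] [MeasurableSpace E] [BorelSpace E] {Y : ℝ → Ω → E}
    (hY : IsContinuousAdapted 𝔽 t₀ T Y) : IsProgressiveOn 𝔽 t₀ T Y := by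
  intro s hs
  refine @measurable_uncurry_of_continuous_of_measurable Ω E (Set.Icc t₀ s) _ _ _ _ _ _ _ _ _
    (𝔽 s.toNNReal) (fun t ω => Y t ω) (fun ω => ?_) (fun t => ?_)
  · exact continuousOn_iff_continuous_domRestrict.1
      ((hY.2 ω).mono (Set.Icc_subset_Icc_right hs.2))
  · exact (hY.1 t ⟨t.2.1, t.2.2.trans hs.2⟩).mono
      (𝔽.mono (Real.toNNReal_le_toNNReal t.2.2)) le_rfl

lemma isContinuousAdapted_deterministic {f : ℝ → ℝ} (hf : ContinuousOn f (Set.Icc t₀ T)) :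
    IsContinuousAdapted 𝔽 t₀ T fun t (_ : Ω) => f t :=
  ⟨fun _ _ => measurable_const, fun _ => hf⟩

lemma lintegral_lintegral_enorm_sq_le [IsProbabilityMeasure P] {H : ℝ → Ω → ℝ} {C : ℝ}
    (hH : ∀ s ∈ Set.Ioc t₀ T, ∀ ω, |H s ω| ≤ C) :
    ∫⁻ ω, (∫⁻ s in Set.Icc t₀ T, ‖H s ω‖ₑ ^ 2) ∂P ≤ ENNReal.ofReal C ^ 2 *
      ENNReal.ofReal (T - t₀) := by
  have hin : ∀ ω, ∫⁻ s in Set.Icc t₀ T, ‖H s ω‖ₑ ^ 2 ≤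
      ENNReal.ofReal C ^ 2 * ENNReal.ofReal (T - t₀) := by
    intro ω
    rw [← restrict_Ioc_eq_restrict_Icc, ← Real.volume_Ioc, ← setLIntegral_const]
    refine setLIntegral_mono measurable_const fun s hs => ?_
    gcongr
    rw [Real.enorm_eq_ofReal_abs]
    exact ENNReal.ofReal_le_ofReal (hH s hs ω)
  refine (lintegral_mono hin).trans ?_
  simp

lemma memH2_deterministic [IsProbabilityMeasure P] {f : ℝ → ℝ}
    (hf : ContinuousOn f (Set.Icc t₀ T)) : MemH2 P 𝔽 t₀ T fun t (_ : Ω) => f t := by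
  refine ⟨(isContinuousAdapted_deterministic hf).isProgressiveOn, ?_⟩
  obtain ⟨C, hC⟩ := isCompact_Icc.exists_bound_of_continuousOn hf
  refine (lintegral_lintegral_enorm_sq_le (C := C) fun s hs _ =>
    hC s (Set.Ioc_subset_Icc_self hs)).trans_lt ?_
  exact ENNReal.mul_lt_top (by simp) ENNReal.ofReal_lt_top

/-- Uniform continuity. The oscillation `(1 / 4) ^ l` is smaller than the accuracy `(1 / 2) ^ l`
later asked of the integrals; the gap makes the tail probabilities summable. -/
lemma exists_dyadic_modulus {f : ℝ → ℝ} (hf : ContinuousOn f (Set.Icc t₀ T)) :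
    ∃ φ : ℕ → ℕ, StrictMono φ ∧ ∀ l, ∀ x ∈ Set.Icc t₀ T, ∀ y ∈ Set.Icc t₀ T,
      |x - y| ≤ (T - t₀) / 2 ^ φ l → |f x - f y| ≤ (1 / 4 : ℝ) ^ l := by
  have huc := isCompact_Icc.uniformContinuousOn_of_continuous hf
  rw [Metric.uniformContinuousOn_iff] at huc
  refine extraction_forall_of_eventually (P := fun l m => ∀ x ∈ Set.Icc t₀ T, ∀ y ∈ Set.Icc t₀ T,
      |x - y| ≤ (T - t₀) / 2 ^ m → |f x - f y| ≤ (1 / 4 : ℝ) ^ l) fun l => ?_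
  obtain ⟨δ, hδ, hfδ⟩ := huc ((1 / 4 : ℝ) ^ l) (by positivity)
  have hlim : Tendsto (fun m : ℕ => (T - t₀) / 2 ^ m) atTop (𝓝 0) := by
    have := (tendsto_pow_atTop_nhds_zero_of_lt_one (r := (1 / 2 : ℝ)) (by norm_num)
      (by norm_num)).const_mul (T - t₀)
    simpa [div_eq_mul_inv] using this
  filter_upwards [hlim.eventually (gt_mem_nhds hδ)] with m hm x hx y hy hxy
  exact (hfδ x hx y hy (by rw [Real.dist_eq]; exact hxy.trans_lt hm)).le

/-- Serves both the Wiener approximations and the Picard iterates. The estimate is required only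
from some index on, because Borel–Cantelli gives no more. -/
lemma exists_tendstoUniformlyOn_of_geometric {α E : Type*} [PseudoMetricSpace E] [CompleteSpace E]
    [Nonempty E] {s : Set α} {J : ℕ → α → E} {C : ℝ} (hC : 0 ≤ C)
    (hJ : ∃ L, ∀ l ≥ L, ∀ t ∈ s, dist (J l t) (J (l + 1) t) ≤ C * (1 / 2 : ℝ) ^ l) :
    ∃ g : α → E, TendstoUniformlyOn J g atTop s := by
  obtain ⟨L, hL⟩ := hJ
  have hdist : ∀ t ∈ s, ∀ n, dist (J (n + L) t) (J (n + 1 + L) t) ≤ C * (1 / 2 : ℝ) ^ n := by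
    intro t ht n
    rw [show n + 1 + L = n + L + 1 by ring]
    exact (hL (n + L) (Nat.le_add_left _ _) t ht).trans (mul_le_mul_of_nonneg_left
      (pow_le_pow_of_le_one (by norm_num) (by norm_num) (Nat.le_add_right n L)) hC)
  have hex : ∀ t, ∃ a, t ∈ s → Tendsto (fun n => J (n + L) t) atTop (𝓝 a) := by
    intro t
    by_cases ht : t ∈ s
    · obtain ⟨a, ha⟩ := cauchySeq_tendsto_of_complete
        (cauchySeq_of_le_geometric (1 / 2) C (by norm_num) (hdist t ht))
      exact ⟨a, fun _ => ha⟩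
    · exact ⟨Classical.arbitrary E, fun h => absurd h ht⟩
  choose g hg using hex
  refine ⟨g, ?_⟩
  rw [Metric.tendstoUniformlyOn_iff]
  intro ε hε
  have hlim : Tendsto (fun n : ℕ => C * (1 / 2 : ℝ) ^ n / (1 - 1 / 2)) atTop (𝓝 0) := by
    have := ((tendsto_pow_atTop_nhds_zero_of_lt_one (r := (1 / 2 : ℝ)) (by norm_num)
      (by norm_num)).const_mul C).div_const (1 - 1 / 2 : ℝ)
    simpa using this
  have hev := hlim.eventually (gt_mem_nhds hε)
  rw [← Filter.map_add_atTop_eq_nat L, eventually_map]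
  filter_upwards [hev] with n hn t ht
  rw [dist_comm]
  exact (dist_le_of_le_geometric_of_tendsto (1 / 2) C (by norm_num) (hdist t ht)
    (hg t ht) n).trans_lt hn

/-- A constant coefficient is known at every time, also when `grid k` lies beyond `t`. -/
lemma SimpleProcess.measurable_integral_adapted (hZ : IsBrownianFor P 𝔽 Z)
    (S : SimpleProcess 𝔽 t₀ T) (hS : ∀ k, ∃ c : ℝ, S.ξ k = fun _ => c) (t : ℝ) :
    Measurable[𝔽 t.toNNReal] (S.integral Z t) := by
  unfold SimpleProcess.integral
  have mZ : ∀ r, Measurable[𝔽 t.toNNReal] (Z (min r t).toNNReal) := fun r =>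
    (hZ.adapted _).mono (𝔽.mono (Real.toNNReal_le_toNNReal (min_le_right _ _))) le_rfl
  refine Finset.measurable_fun_sum _ fun k _ => ?_
  obtain ⟨c, hc⟩ := hS k
  simp only [hc]
  exact ((mZ _).sub (mZ _)).const_mul c

variable (𝔽) in
/-- The approximation of `f` by its values at the left end points of the dyadic intervals. -/
noncomputable abbrev dyadicApprox (h : t₀ ≤ T) (f : ℝ → ℝ) (m : ℕ) : SimpleProcess 𝔽 t₀ T :=
  dyadicProcess 𝔽 h m fun k => f (dyadicGrid t₀ T m k)

lemma abs_dyadicApprox_value_sub_le (h : t₀ ≤ T) {f : ℝ → ℝ} {m : ℕ} {δ : ℝ}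
    (hδ : ∀ x ∈ Set.Icc t₀ T, ∀ y ∈ Set.Icc t₀ T, |x - y| ≤ (T - t₀) / 2 ^ m → |f x - f y| ≤ δ)
    {s : ℝ} (hs : s ∈ Set.Ioc t₀ T) (ω : Ω) :
    |(dyadicApprox 𝔽 h f m).value s ω - f s| ≤ δ := by
  obtain ⟨k, hk, hv⟩ := dyadicProcess_value (𝔽 := 𝔽) h m (fun k => f (dyadicGrid t₀ T m k)) hs ω
  rw [hv]
  refine hδ _ (dyadicGrid_mem h m k) _ (Set.Ioc_subset_Icc_self hs) ?_
  have := dyadicGrid_succ_le h m k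
  rw [abs_sub_comm, abs_of_nonneg (sub_nonneg.2 hk.1.le)]
  linarith [hk.2]

lemma IsBrownianFor.measure_dyadicApprox_sub [IsProbabilityMeasure P] (hZ : IsBrownianFor P 𝔽 Z)
    (ht₀ : 0 ≤ t₀) (h : t₀ < T) {f : ℝ → ℝ} {m m' l : ℕ} (hm : m ≤ m')
    (hδ : ∀ x ∈ Set.Icc t₀ T, ∀ y ∈ Set.Icc t₀ T, |x - y| ≤ (T - t₀) / 2 ^ m →
      |f x - f y| ≤ (1 / 4 : ℝ) ^ l) :
    P {ω | ∃ t ∈ Set.Icc t₀ T, (1 / 2 : ℝ) ^ l < |(dyadicApprox 𝔽 h.le f m).integral Z t ω -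
        (dyadicApprox 𝔽 h.le f m').integral Z t ω|} ≤
      ENNReal.ofReal (2 * Real.exp ((T - t₀) / 2) * Real.exp (-(l : ℝ))) := by
  obtain ⟨r, rfl⟩ := Nat.exists_eq_add_of_le hm
  simp only [dyadicProcess_integral_add h.le Z m r, dyadicProcess_integral_sub]
  -- The weights are at most `4 ^ (-l)`. With exponential parameter `4 ^ l` and threshold `2 ^ (-l)`
  -- the variance term is bounded and the exponent is `-2 ^ l + (T - t₀) / 2`, where `2 ^ l ≥ l`.
  refine (hZ.measure_exists_lt_abs_dyadic ht₀ h (m + r) (K := (1 / 4 : ℝ) ^ l) (fun k => ?_)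
    (l := 4 ^ l) (by positivity) _).trans (ENNReal.ofReal_le_ofReal ?_)
  · exact hδ _ (dyadicGrid_mem h.le _ _) _ (dyadicGrid_mem h.le _ _)
      (abs_dyadicGrid_div_sub_le h.le m r k)
  · rw [mul_assoc 2, ← Real.exp_add]
    have e1 : (4 : ℝ) ^ l * (1 / 2) ^ l = 2 ^ l := by rw [← mul_pow]; norm_num
    have e2 : ((4 : ℝ) ^ l) ^ 2 * ((1 / 4 : ℝ) ^ l) ^ 2 = 1 := by
      rw [← mul_pow, ← mul_pow]; norm_num
    have e3 : (l : ℝ) ≤ 2 ^ l := by exact_mod_cast Nat.lt_two_pow_self.le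
    rw [e1, e2]
    refine mul_le_mul_of_nonneg_left (Real.exp_le_exp.2 ?_) zero_le_two
    linarith

/-- The integral of a continuous deterministic function against a Brownian motion exists, and its
maximum has Gaussian tails. -/
theorem IsBrownianFor.exists_isItoIntegral [IsProbabilityMeasure P] (hZ : IsBrownianFor P 𝔽 Z)
    (ht₀ : 0 ≤ t₀) (h : t₀ < T) {f : ℝ → ℝ} (hf : ContinuousOn f (Set.Icc t₀ T)) :
    ∃ I : ℝ → Ω → ℝ, IsItoIntegral P 𝔽 t₀ T Z (fun t _ => f t) I ∧
      ∃ V : ℝ, ∀ l ≥ 0, ∀ ε : ℝ, P {ω | ∃ t ∈ Set.Icc t₀ T, ε < |I t ω|} ≤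
        ENNReal.ofReal (2 * Real.exp (-(l * ε) + l ^ 2 * V)) := by
  classical
  obtain ⟨φ, hφ, hmod⟩ := exists_dyadic_modulus hf
  obtain ⟨K, hK⟩ := isCompact_Icc.exists_bound_of_continuousOn hf
  set S : ℕ → SimpleProcess 𝔽 t₀ T := fun l => dyadicApprox 𝔽 h.le f (φ l) with hS
  -- almost surely, the paths of the approximations converge uniformly
  have hgood : ∀ᵐ ω ∂P, Continuous (Z · ω) ∧ ∃ L, ∀ l ≥ L, ∀ t ∈ Set.Icc t₀ T,
      |(S l).integral Z t ω - (S (l + 1)).integral Z t ω| ≤ (1 / 2 : ℝ) ^ l := by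
    have hsum : ∑' l, P {ω | ∃ t ∈ Set.Icc t₀ T, (1 / 2 : ℝ) ^ l <
        |(S l).integral Z t ω - (S (l + 1)).integral Z t ω|} ≠ ∞ := by
      refine ne_top_of_le_ne_top ?_ (ENNReal.tsum_le_tsum fun l =>
        hZ.measure_dyadicApprox_sub ht₀ h (hφ (Nat.lt_succ_self l)).le (hmod l))
      exact (Real.summable_exp_neg_nat.mul_left _).tsum_ofReal_ne_top
    filter_upwards [hZ.cont, ae_eventually_notMem hsum] with ω h1 h2
    refine ⟨h1, ?_⟩
    obtain ⟨L, hL⟩ := eventually_atTop.1 h2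
    refine ⟨L, fun l hl t ht => ?_⟩
    by_contra hcon
    exact hL l hl ⟨t, ht, not_le.1 hcon⟩
  -- On `N` the integral is set to zero. All paths then become continuous, and adaptedness survives
  -- because `N` is known at every time.
  obtain ⟨N, hN0, hNm, hN⟩ := hZ.null_mem_of_ae hgood
  have hex : ∀ ω, ∃ g : ℝ → ℝ, (ω ∉ N → TendstoUniformlyOn (fun l t => (S l).integral Z t ω) g
      atTop (Set.Icc t₀ T)) ∧ (ω ∈ N → g = 0) := by
    intro ω
    by_cases hω : ω ∈ N
    · exact ⟨0, fun h => absurd hω h, fun _ => rfl⟩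
    · obtain ⟨g, hg⟩ := exists_tendstoUniformlyOn_of_geometric zero_le_one
        (J := fun l t => (S l).integral Z t ω) (s := Set.Icc t₀ T)
        (by simpa only [Real.dist_eq, one_mul] using (hN ω hω).2)
      exact ⟨g, fun _ => hg, fun h => absurd h hω⟩
  choose I' hI' hI'0 using hex
  set I : ℝ → Ω → ℝ := fun t ω => I' ω t with hI
  have hNae : ∀ᵐ ω ∂P, ω ∉ N := measure_eq_zero_iff_ae_notMem.1 hN0
  have hlim : ∀ ω ∉ N, ∀ t ∈ Set.Icc t₀ T,
      Tendsto (fun l => (S l).integral Z t ω) atTop (𝓝 (I t ω)) := fun ω hω t ht =>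
    (hI' ω hω).tendsto_at ht
  have hadapt : ∀ l t, Measurable[𝔽 t.toNNReal] ((S l).integral Z t) := fun l t =>
    (S l).measurable_integral_adapted hZ (fun k => ⟨_, rfl⟩) t
  have hIc : IsContinuousAdapted 𝔽 t₀ T I := by
    refine ⟨fun t ht => ?_, fun ω => ?_⟩
    · refine @measurable_of_tendsto_metrizable Ω ℝ (𝔽 t.toNNReal) _ _ _ _
        (fun l => Nᶜ.indicator ((S l).integral Z t)) _
        (fun l => (hadapt l t).indicator (hNm _).compl) ?_
      rw [tendsto_pi_nhds]
      intro ω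
      by_cases hω : ω ∈ N
      · have e : I t ω = 0 := by simp [hI, hI'0 ω hω]
        simp [hω, e]
      · simpa [Set.indicator, hω] using hlim ω hω t ht
    · by_cases hω : ω ∈ N
      · simp only [hI, hI'0 ω hω]
        exact continuousOn_const
      · refine (hI' ω hω).continuousOn (Frequently.of_forall fun l => ?_)
        exact ((S l).continuous_integral (hN ω hω).1).continuousOn
  have hval : ∀ l, ∀ s ∈ Set.Ioc t₀ T, ∀ ω, |(S l).value s ω - f s| ≤ (1 / 4 : ℝ) ^ l :=
    fun l s hs ω => abs_dyadicApprox_value_sub_le h.le (hmod l) hs ω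
  have hpow : Tendsto (fun l : ℕ => ENNReal.ofReal (2 * (1 / 4 : ℝ) ^ l) ^ 2 *
      ENNReal.ofReal (T - t₀)) atTop (𝓝 0) := by
    have h1 : Tendsto (fun l : ℕ => 2 * (1 / 4 : ℝ) ^ l) atTop (𝓝 0) := by
      simpa using (tendsto_pow_atTop_nhds_zero_of_lt_one (r := (1 / 4 : ℝ)) (by norm_num)
        (by norm_num)).const_mul 2
    have h2 := ENNReal.Tendsto.mul_const (b := ENNReal.ofReal (T - t₀))
      (ENNReal.Tendsto.pow (n := 2) (ENNReal.tendsto_ofReal h1)) (Or.inr ENNReal.ofReal_ne_top)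
    simpa using h2
  refine ⟨I, ⟨memH2_deterministic hf, hIc, S, ?_, fun t ht => ?_⟩,
    K ^ 2 * (T - t₀) / 2, fun l hl ε => ?_⟩
  · refine tendsto_of_tendsto_of_tendsto_of_le_of_le tendsto_const_nhds hpow (fun _ => zero_le)
      fun l => lintegral_lintegral_enorm_sq_le fun s hs ω => (hval l s hs ω).trans ?_
    have : (0 : ℝ) ≤ (1 / 4 : ℝ) ^ l := by positivity
    linarith
  · refine tendsto_of_tendsto_of_tendsto_of_le_of_le tendsto_const_nhds hpow (fun _ => zero_le)
      fun l => ?_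
    have hm : ∀ l', Measurable
        fun ω => ‖(S l).integral Z t ω - (S l').integral Z t ω‖ₑ ^ 2 := fun l' =>
      ((((S l).measurable_integral hZ.measurable t).sub
        ((S l').measurable_integral hZ.measurable t)).enorm).pow_const 2
    -- Fatou's lemma replaces the limit by later approximations, whose distance to the `l`-th is
    -- controlled by the isometry.
    calc ∫⁻ ω, ‖(S l).integral Z t ω - I t ω‖ₑ ^ 2 ∂P
        = ∫⁻ ω, liminf (fun l' => ‖(S l).integral Z t ω - (S l').integral Z t ω‖ₑ ^ 2) atTop
            ∂P := by
          refine lintegral_congr_ae ?_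
          filter_upwards [hNae] with ω hω
          refine (Tendsto.liminf_eq ?_).symm
          exact ENNReal.Tendsto.pow (tendsto_const_nhds.sub (hlim ω hω t ht)).enorm
      _ ≤ liminf (fun l' => ∫⁻ ω, ‖(S l).integral Z t ω - (S l').integral Z t ω‖ₑ ^ 2 ∂P) atTop :=
          lintegral_liminf_le hm
      _ ≤ ENNReal.ofReal (2 * (1 / 4 : ℝ) ^ l) ^ 2 * ENNReal.ofReal (T - t₀) := by
          refine liminf_le_of_le (by isBoundedDefault) fun b hb => ?_
          obtain ⟨l', hl', hbl⟩ := (hb.and (eventually_ge_atTop l)).exists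
          refine hl'.trans ((hZ.lintegral_integral_sub_integral_sq ht₀ _ _ ht).trans ?_)
          refine lintegral_lintegral_enorm_sq_le fun s hs ω => ?_
          have h1 := abs_le.1 (hval l s hs ω)
          have h2 := abs_le.1 (hval l' s hs ω)
          have h3 : (1 / 4 : ℝ) ^ l' ≤ (1 / 4 : ℝ) ^ l :=
            pow_le_pow_of_le_one (by norm_num) (by norm_num) hbl
          rw [abs_le]
          constructor <;> linarith [h1.1, h1.2, h2.1, h2.2]
  -- An exceedance of the limit at `t` is shared by all late approximations at the same `t`, and
  -- their tail bound involves only `K`, the bound of `|f|`, not the level.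
  · set A : ℕ → Set Ω := fun i => {ω | ∃ t ∈ Set.Icc t₀ T, ε < |(S i).integral Z t ω|} with hA
    have hAle : ∀ i, P (A i) ≤
        ENNReal.ofReal (2 * Real.exp (-(l * ε) + l ^ 2 * (K ^ 2 * (T - t₀) / 2))) := by
      intro i
      have := hZ.measure_exists_lt_abs_dyadic ht₀ h (φ i)
        (c := fun k => f (dyadicGrid t₀ T (φ i) k)) (K := K)
        (fun k => hK _ (dyadicGrid_mem h.le _ k)) hl ε
      refine this.trans (ENNReal.ofReal_le_ofReal (le_of_eq ?_))
      ring_nf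
    have hsub : {ω | ∃ t ∈ Set.Icc t₀ T, ε < |I t ω|} ≤ᵐ[P] ⋃ L, ⋂ i ≥ L, A i := by
      filter_upwards [hNae] with ω hω
      rintro ⟨t, ht, hε⟩
      obtain ⟨L, hL⟩ := eventually_atTop.1 (((hlim ω hω t ht).abs).eventually (lt_mem_nhds hε))
      exact Set.mem_iUnion.2 ⟨L, Set.mem_iInter₂.2 fun i hi => ⟨t, ht, hL i hi⟩⟩
    refine (measure_mono_ae hsub).trans ?_
    have hmono : Monotone fun L => ⋂ i ≥ L, A i := fun L L' hLL' =>
      Set.biInter_mono (fun i (hi : i ≥ L') => hLL'.trans hi) fun _ _ => subset_rfl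
    rw [hmono.measure_iUnion]
    exact iSup_le fun L => (measure_mono (Set.biInter_subset_of_mem (le_refl L))).trans (hAle L)

end

end CARAGame

namespace CARAGame

/-! ### Exponential moments -/

section Moments

variable {Ω : Type*} {mΩ : MeasurableSpace Ω} {P : Measure Ω}

/-- All exponential moments of `M` are finite; `M` need not be measurable. -/
def HasExpMoments (P : Measure Ω) (M : Ω → ℝ) : Prop :=
  ∀ c : ℝ, 0 ≤ c → ∃ G : Ω → ℝ≥0∞, Measurable G ∧ ∫⁻ ω, G ω ∂P < ∞ ∧
    ∀ ω, ENNReal.ofReal (Real.exp (c * M ω)) ≤ G ω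

lemma HasExpMoments.const_add_mul {M : Ω → ℝ} (hM : HasExpMoments P M) (a : ℝ) {b : ℝ}
    (hb : 0 ≤ b) : HasExpMoments P fun ω => a + b * M ω := by
  intro c hc
  obtain ⟨G, hGm, hG, hle⟩ := hM (c * b) (mul_nonneg hc hb)
  refine ⟨fun ω => ENNReal.ofReal (Real.exp (c * a)) * G ω, hGm.const_mul _, ?_, fun ω => ?_⟩
  · rw [lintegral_const_mul _ hGm]
    exact ENNReal.mul_lt_top ENNReal.ofReal_lt_top hG
  · simp only
    rw [mul_add, Real.exp_add, ENNReal.ofReal_mul (Real.exp_pos _).le, ← mul_assoc c b]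
    exact mul_le_mul_right (hle ω) _

/-- A sum of two terms is at most twice the larger, so `exp (c * (x + y)) ≤ exp (2 * c * x) + exp (2
* c * y)`; no independence enters. -/
lemma hasExpMoments_sum [IsProbabilityMeasure P] {ι : Type*} (s : Finset ι) {M : ι → Ω → ℝ}
    (hM : ∀ i, HasExpMoments P (M i)) : HasExpMoments P fun ω => ∑ i ∈ s, M i ω := by
  classical
  induction s using Finset.induction_on with
  | empty =>
    intro c _
    exact ⟨fun _ => 1, measurable_const, by simp, fun ω => by simp⟩
  | insert i s hi ih =>
    intro c hc
    obtain ⟨G, hGm, hG, hle⟩ := ih (2 * c) (by positivity)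
    obtain ⟨G', hGm', hG', hle'⟩ := hM i (2 * c) (by positivity)
    refine ⟨fun ω => G' ω + G ω, hGm'.add hGm, ?_, fun ω => ?_⟩
    · rw [lintegral_add_left hGm']
      exact ENNReal.add_lt_top.2 ⟨hG', hG⟩
    · simp only at hle ⊢
      rw [Finset.sum_insert hi]
      rcases le_total (M i ω) (∑ j ∈ s, M j ω) with h | h
      · refine le_trans (ENNReal.ofReal_le_ofReal (Real.exp_le_exp.2 ?_))
          ((hle ω).trans le_add_self)
        nlinarith
      · refine le_trans (ENNReal.ofReal_le_ofReal (Real.exp_le_exp.2 ?_))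
          ((hle' ω).trans le_self_add)
        nlinarith

/-- A process with continuous paths and Gaussian tails has a maximum with exponential moments. -/
lemma exists_hasExpMoments_of_tail [IsProbabilityMeasure P] {t₀ T : ℝ} (h : t₀ ≤ T)
    {I : ℝ → Ω → ℝ}
    (hI : ∀ ω, ContinuousOn (fun t => I t ω) (Set.Icc t₀ T)) {V : ℝ}
    (htail : ∀ l ≥ 0, ∀ ε : ℝ, P {ω | ∃ t ∈ Set.Icc t₀ T, ε < |I t ω|} ≤
        ENNReal.ofReal (2 * Real.exp (-(l * ε) + l ^ 2 * V))) :
    ∃ M : Ω → ℝ, HasExpMoments P M ∧ ∀ ω, ∀ t ∈ Set.Icc t₀ T, |I t ω| ≤ M ω := by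
  have hmax : ∀ ω, ∃ t ∈ Set.Icc t₀ T, ∀ s ∈ Set.Icc t₀ T, |I s ω| ≤ |I t ω| := fun ω => by
    obtain ⟨t, ht, hmax⟩ := isCompact_Icc.exists_isMaxOn (Set.nonempty_Icc.2 h) (hI ω).abs
    exact ⟨t, ht, hmax⟩
  choose τ hτ hτmax using hmax
  -- The maximizing time `τ` is merely chosen, with no measurability in `ω`; hence the measurable
  -- hulls `A k` below.
  refine ⟨fun ω => |I (τ ω) ω|, fun c hc => ?_, hτmax⟩
  set A : ℕ → Set Ω := fun k => toMeasurable P {ω | ∃ t ∈ Set.Icc t₀ T, (k : ℝ) < |I t ω|} with hA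
  have hAm : ∀ k, MeasurableSet (A k) := fun k => measurableSet_toMeasurable _ _
  have hAle : ∀ k : ℕ, P (A k) ≤
      ENNReal.ofReal (2 * Real.exp (-((c + 1) * k) + (c + 1) ^ 2 * V)) := fun k => by
    rw [hA, measure_toMeasurable]
    exact htail (c + 1) (by positivity) k
  -- If the maximum lies in `(k, k + 1]` then `ω ∈ A k` and `a k` dominates; the extra `1` covers
  -- maximum zero. The tail bound with `l = c + 1` leaves `exp (-k)` in the `k`-th term.
  set a : ℕ → ℝ≥0∞ := fun k => ENNReal.ofReal (Real.exp (c * (k + 1))) with ha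
  refine ⟨fun ω => 1 + ∑' k, (A k).indicator (fun _ => a k) ω, ?_, ?_, fun ω => ?_⟩
  · have hm : ∀ k, Measurable ((A k).indicator fun _ => a k) := fun k =>
      measurable_const.indicator (hAm k)
    exact measurable_const.add (Measurable.tsum hm)
  · rw [lintegral_add_left measurable_const,
      lintegral_tsum fun k => (measurable_const.indicator (hAm k)).aemeasurable]
    refine ENNReal.add_lt_top.2 ⟨by simp, lt_of_le_of_lt (ENNReal.tsum_le_tsum (g := fun k : ℕ =>
      ENNReal.ofReal (2 * Real.exp (c + (c + 1) ^ 2 * V) * Real.exp (-(k : ℝ)))) fun k => ?_)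
      (Real.summable_exp_neg_nat.mul_left _).tsum_ofReal_lt_top⟩
    rw [lintegral_indicator (hAm k), setLIntegral_const]
    calc a k * P (A k)
        ≤ a k * ENNReal.ofReal (2 * Real.exp (-((c + 1) * k) + (c + 1) ^ 2 * V)) := by
          gcongr; exact hAle k
      _ = _ := by
        simp only [ha]
        rw [← ENNReal.ofReal_mul (Real.exp_pos _).le]
        congr 1
        rw [mul_left_comm, ← Real.exp_add, mul_assoc, ← Real.exp_add]
        ring_nf
  · by_cases h0 : |I (τ ω) ω| = 0
    · simp [h0]
    have hpos : 0 < |I (τ ω) ω| := lt_of_le_of_ne (abs_nonneg _) (Ne.symm h0)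
    obtain ⟨k, hk⟩ : ∃ k : ℕ, ⌈|I (τ ω) ω|⌉₊ = k + 1 :=
      Nat.exists_eq_succ_of_ne_zero (Nat.ceil_pos.2 hpos).ne'
    have h1 : |I (τ ω) ω| ≤ k + 1 := by
      have := Nat.le_ceil |I (τ ω) ω|
      rw [hk] at this
      exact_mod_cast this
    have h2 : (k : ℝ) < |I (τ ω) ω| := Nat.lt_ceil.1 (by rw [hk]; exact Nat.lt_succ_self k)
    have hmem : ω ∈ A k := subset_toMeasurable _ _ ⟨τ ω, hτ ω, h2⟩
    refine le_trans ?_ (le_add_left (ENNReal.le_tsum k))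
    rw [Set.indicator_of_mem hmem]
    exact ENNReal.ofReal_le_ofReal (Real.exp_le_exp.2 (mul_le_mul_of_nonneg_left h1 hc))

end Moments

/-! ### Integral equations with Lipschitz coefficients -/

section Deterministic

variable {t₀ T : ℝ}

/-- The primitive `u` of `φ` satisfies `u' ≤ C + K * u`, so the differential form of Gronwall's
inequality bounds `u`, and the hypothesis returns the bound to `φ`. -/
lemma le_mul_exp_of_le_add_integral {φ : ℝ → ℝ} (hφ : ContinuousOn φ (Set.Icc t₀ T)) {C K : ℝ}
    (hC : 0 ≤ C) (hK : 0 ≤ K)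
    (h : ∀ t ∈ Set.Icc t₀ T, φ t ≤ C + K * ∫ s in t₀..t, φ s) {t : ℝ} (ht : t ∈ Set.Icc t₀ T) :
    φ t ≤ C * Real.exp (K * (T - t₀)) := by
  have hle : t₀ ≤ T := ht.1.trans ht.2
  have hexp : Real.exp (K * (t - t₀)) ≤ Real.exp (K * (T - t₀)) :=
    Real.exp_le_exp.2 (mul_le_mul_of_nonneg_left (by linarith [ht.2]) hK)
  refine le_trans ?_ (mul_le_mul_of_nonneg_left hexp hC)
  -- Extending `φ` by its end values makes the primitive differentiable everywhere.
  set ψ : ℝ → ℝ := Set.IccExtend hle ((Set.Icc t₀ T).domRestrict φ) with hψ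
  have hψc : Continuous ψ :=
    (continuousOn_iff_continuous_domRestrict.1 hφ).Icc_extend'
  have hψe : ∀ s ∈ Set.Icc t₀ T, ψ s = φ s := fun s hs => by
    rw [hψ, Set.IccExtend_of_mem _ _ hs]; rfl
  have hint_f : ∀ s ∈ Set.Icc t₀ T, ∫ r in t₀..s, φ r = ∫ r in t₀..s, ψ r := fun s hs =>
    intervalIntegral.integral_congr fun r hr => by
      rw [Set.uIcc_of_le hs.1] at hr
      exact (hψe r ⟨hr.1, hr.2.trans hs.2⟩).symm
  have hd : ∀ s, HasDerivAt (fun s => ∫ r in t₀..s, ψ r) (ψ s) s := fun s =>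
    intervalIntegral.integral_hasDerivAt_right (hψc.intervalIntegrable _ _)
      hψc.aestronglyMeasurable.stronglyMeasurableAtFilter hψc.continuousAt
  have hg := le_gronwallBound_of_liminf_deriv_right_le (f := fun s => ∫ r in t₀..s, ψ r)
    (f' := ψ) (δ := 0) (K := K) (ε := C) (a := t₀) (b := T)
    (fun s _ => (hd s).continuousAt.continuousWithinAt)
    (fun s _ r hr => (hd s).hasDerivWithinAt.liminf_right_slope_le hr) (by simp)
    (fun s hs => by
      rw [hψe s (Set.Ico_subset_Icc_self hs), ← hint_f s (Set.Ico_subset_Icc_self hs), add_comm]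
      exact h s (Set.Ico_subset_Icc_self hs)) t ht
  refine (h t ht).trans ?_
  rw [hint_f t ht]
  rcases eq_or_lt_of_le hK with rfl | hK'
  · simp
  · rw [gronwallBound_of_K_ne_0 hK'.ne'] at hg
    have := mul_le_mul_of_nonneg_left hg hK
    have e : K * (0 * Real.exp (K * (t - t₀)) + C / K * (Real.exp (K * (t - t₀)) - 1)) =
        C * Real.exp (K * (t - t₀)) - C := by field_simp; ring
    rw [e] at this
    linarith

variable {E : Type*} [NormedAddCommGroup E] [NormedSpace ℝ E]

/-- Picard iterates for the integral equation `x t = g t + ∫ s in t₀..t, F s (x s)`. -/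
noncomputable def picardIterate (t₀ : ℝ) (F : ℝ → E → E) (g : ℝ → E) : ℕ → ℝ → E
  | 0 => g
  | k + 1 => fun t => g t + ∫ s in t₀..t, F s (picardIterate t₀ F g k s)

variable {F : ℝ → E → E} {g : ℝ → E}

lemma continuous_picardIterate (hF : Continuous fun p : ℝ × E => F p.1 p.2) (hg : Continuous g)
    (k : ℕ) : Continuous (picardIterate t₀ F g k) := by
  induction k with
  | zero => exact hg
  | succ k ih =>
    refine hg.add (intervalIntegral.continuous_primitive (fun a b => ?_) t₀)
    exact (hF.comp (continuous_id.prodMk ih)).intervalIntegrable _ _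

/-- With the weight `exp (-2 * K * (t - t₀))` the Picard map contracts by `1 / 2` on the whole
interval, so no subdivision is needed. The convergence of the iterates is part of the conclusion
because the solution inherits its measurability in `ω` from them. -/
lemma exists_tendstoUniformlyOn_picardIterate [CompleteSpace E] (h : t₀ ≤ T)
    (hF : Continuous fun p : ℝ × E => F p.1 p.2) (hg : Continuous g) {K : ℝ} (hK : 0 < K)
    (hL : ∀ s x y, ‖F s x - F s y‖ ≤ K * ‖x - y‖) :
    ∃ x : ℝ → E, TendstoUniformlyOn (picardIterate t₀ F g) x atTop (Set.Icc t₀ T) ∧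
      ContinuousOn x (Set.Icc t₀ T) ∧
      ∀ t ∈ Set.Icc t₀ T, x t = g t + ∫ s in t₀..t, F s (x s) := by
  set p := picardIterate t₀ F g with hp
  have hpc : ∀ k, Continuous (p k) := continuous_picardIterate hF hg
  have hFc : ∀ k, Continuous fun s => F s (p k s) := fun k =>
    hF.comp (continuous_id.prodMk (hpc k))
  obtain ⟨C, hC⟩ := (isCompact_Icc (a := t₀) (b := T)).exists_bound_of_continuousOn
    ((hpc 0).sub (hpc 1)).continuousOn
  have hC0 : 0 ≤ C := (norm_nonneg _).trans (hC t₀ (Set.left_mem_Icc.2 h))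
  have hbound : ∀ k, ∀ t ∈ Set.Icc t₀ T,
      ‖p k t - p (k + 1) t‖ ≤ C * (1 / 2) ^ k * Real.exp (2 * K * (t - t₀)) := by
    intro k
    induction k with
    | zero =>
      intro t ht
      refine (hC t ht).trans ?_
      rw [pow_zero, mul_one]
      refine le_mul_of_one_le_right hC0 (Real.one_le_exp ?_)
      have := sub_nonneg.2 ht.1
      positivity
    | succ k ih =>
      intro t ht
      have e : p (k + 1) t - p (k + 2) t = ∫ s in t₀..t, (F s (p k s) - F s (p (k + 1) s)) := by
        rw [intervalIntegral.integral_sub ((hFc k).intervalIntegrable _ _)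
          ((hFc (k + 1)).intervalIntegrable _ _)]
        simp only [hp, picardIterate]
        abel
      rw [e]
      set D := C * (1 / 2 : ℝ) ^ k with hD
      have hder : ∀ s, HasDerivAt (fun s => D / 2 * Real.exp (2 * K * (s - t₀)))
          (K * (D * Real.exp (2 * K * (s - t₀)))) s := by
        intro s
        have h1 : HasDerivAt (fun s : ℝ => 2 * K * (s - t₀)) (2 * K) s := by
          simpa using ((hasDerivAt_id s).sub_const t₀).const_mul (2 * K)
        refine (h1.exp.const_mul (D / 2)).congr_deriv ?_
        ring
      have hcont : Continuous fun s => K * (D * Real.exp (2 * K * (s - t₀))) := by fun_prop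
      have hI := intervalIntegral.integral_eq_sub_of_hasDerivAt (a := t₀) (b := t)
        (fun s _ => hder s) (hcont.intervalIntegrable _ _)
      have hn : ‖∫ s in t₀..t, (F s (p k s) - F s (p (k + 1) s))‖ ≤
          ∫ s in t₀..t, K * (D * Real.exp (2 * K * (s - t₀))) := by
        refine intervalIntegral.norm_integral_le_of_norm_le ht.1 (ae_of_all _ fun s hs => ?_)
          (hcont.intervalIntegrable _ _)
        refine (hL s _ _).trans (mul_le_mul_of_nonneg_left (ih s ⟨hs.1.le, hs.2.trans ht.2⟩) hK.le)
      refine hn.trans ?_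
      rw [hI]
      have hD0 : 0 ≤ D := by positivity
      have : D / 2 * Real.exp (2 * K * (t - t₀)) = C * (1 / 2) ^ (k + 1) *
          Real.exp (2 * K * (t - t₀)) := by rw [hD, pow_succ]; ring
      rw [← this]
      simp only [sub_self, mul_zero, Real.exp_zero, mul_one]
      linarith
  obtain ⟨x, hx⟩ := exists_tendstoUniformlyOn_of_geometric (J := p) (s := Set.Icc t₀ T)
    (C := C * Real.exp (2 * K * (T - t₀))) (by positivity) ⟨0, fun k _ t ht => by
      rw [dist_eq_norm]
      refine (hbound k t ht).trans ?_
      rw [mul_right_comm]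
      have := ht.2
      gcongr⟩
  have hxc : ContinuousOn x (Set.Icc t₀ T) :=
    hx.continuousOn (Frequently.of_forall fun k => (hpc k).continuousOn)
  refine ⟨x, hx, hxc, fun t ht => ?_⟩
  have hFx : ContinuousOn (fun s => F s (x s)) (Set.Icc t₀ T) :=
    hF.comp_continuousOn (continuousOn_id.prodMk hxc)
  have hFxi : IntervalIntegrable (fun s => F s (x s)) volume t₀ t := by
    refine ContinuousOn.intervalIntegrable ?_
    rw [Set.uIcc_of_le ht.1]
    exact hFx.mono (Set.Icc_subset_Icc_right ht.2)
  have hlim1 : Tendsto (fun k => p (k + 1) t) atTop (𝓝 (x t)) :=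
    (hx.tendsto_at ht).comp (tendsto_add_atTop_nat 1)
  have hlim2 : Tendsto (fun k => p (k + 1) t) atTop (𝓝 (g t + ∫ s in t₀..t, F s (x s))) := by
    have e : ∀ k, p (k + 1) t = g t + ∫ s in t₀..t, F s (p k s) := fun k => rfl
    simp only [e]
    refine tendsto_const_nhds.add ?_
    rw [Metric.tendsto_atTop]
    intro ε hε
    have hpos : 0 < K * (T - t₀) + 1 := by
      have := sub_nonneg.2 h
      positivity
    obtain ⟨N, hN⟩ := eventually_atTop.1
      ((Metric.tendstoUniformlyOn_iff.1 hx) (ε / (K * (T - t₀) + 1)) (by positivity))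
    refine ⟨N, fun k hk => ?_⟩
    rw [dist_eq_norm, ← intervalIntegral.integral_sub ((hFc k).intervalIntegrable _ _) hFxi]
    have hn : ‖∫ s in t₀..t, (F s (p k s) - F s (x s))‖ ≤
        K * (ε / (K * (T - t₀) + 1)) * |t - t₀| := by
      refine intervalIntegral.norm_integral_le_of_norm_le_const fun s hs => ?_
      rw [Set.uIoc_of_le ht.1] at hs
      refine (hL s _ _).trans (mul_le_mul_of_nonneg_left ?_ hK.le)
      have := hN k hk s ⟨hs.1.le, hs.2.trans ht.2⟩
      rw [dist_comm, dist_eq_norm] at this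
      exact this.le
    refine hn.trans_lt ?_
    rw [abs_of_nonneg (sub_nonneg.2 ht.1)]
    calc K * (ε / (K * (T - t₀) + 1)) * (t - t₀) ≤ K * (ε / (K * (T - t₀) + 1)) * (T - t₀) := by
          have := ht.2
          gcongr
      _ = ε * (K * (T - t₀) / (K * (T - t₀) + 1)) := by ring
      _ < ε * 1 := by
          refine mul_lt_mul_of_pos_left ?_ hε
          rw [div_lt_one hpos]; linarith
      _ = ε := mul_one ε
  exact tendsto_nhds_unique hlim1 hlim2

end Deterministic

/-! ### Adaptedness of the Picard iterates. -/

section Measurability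

variable {Ω E : Type*} [NormedAddCommGroup E] [NormedSpace ℝ E] [MeasurableSpace E] [BorelSpace E]
  [SecondCountableTopology E] {t₀ T : ℝ}

/-- The σ-algebra `m` is arbitrary, to be taken as `𝔽 t`. Projecting time onto `[t₀, t]` gives an
integrand jointly measurable for `m`. -/
lemma measurable_intervalIntegral_of_continuousOn {m : MeasurableSpace Ω} {H : ℝ → Ω → E} {t : ℝ}
    (ht : t₀ ≤ t) (hc : ∀ ω, ContinuousOn (fun s => H s ω) (Set.Icc t₀ t))
    (hm : ∀ s ∈ Set.Icc t₀ t, Measurable (H s)) : Measurable fun ω => ∫ s in t₀..t, H s ω := by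
  set H' : ℝ → Ω → E := fun s ω => H (Set.projIcc t₀ t ht s) ω with hH'
  have hm' : Measurable (Function.uncurry H') := by
    refine measurable_uncurry_of_continuous_of_measurable (fun ω => ?_) fun s => ?_
    · exact (continuousOn_iff_continuous_domRestrict.1 (hc ω)).comp continuous_projIcc
    · exact hm _ (Set.projIcc t₀ t ht s).2
  have e : ∀ ω, ∫ s in t₀..t, H s ω = ∫ s in Set.Ioc t₀ t, H' s ω := by
    intro ω
    rw [intervalIntegral.integral_of_le ht]
    refine setIntegral_congr_fun measurableSet_Ioc fun s hs => ?_
    simp only [hH', Set.projIcc_of_mem ht (Set.Ioc_subset_Icc_self hs)]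
  simp only [e]
  have hsm : StronglyMeasurable (fun p : Ω × ℝ => H' p.2 p.1) :=
    (hm'.comp measurable_swap).stronglyMeasurable
  exact (StronglyMeasurable.integral_prod_right
    (ν := volume.restrict (Set.Ioc t₀ t)) hsm).measurable

lemma measurable_picardIterate {mΩ : MeasurableSpace Ω} {𝔽 : Filtration ℝ≥0 mΩ} {F : ℝ → E → E}
    {g : Ω → ℝ → E} (hF : Continuous fun p : ℝ × E => F p.1 p.2) (hg : ∀ ω, Continuous (g ω))
    (hgm : ∀ t ∈ Set.Icc t₀ T, Measurable[𝔽 t.toNNReal] fun ω => g ω t) (k : ℕ) :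
    ∀ t ∈ Set.Icc t₀ T, Measurable[𝔽 t.toNNReal] fun ω => picardIterate t₀ F (g ω) k t := by
  induction k with
  | zero => exact hgm
  | succ k ih =>
    intro t ht
    refine (hgm t ht).add (@measurable_intervalIntegral_of_continuousOn Ω E _ _ _ _ _ t₀
      (𝔽 t.toNNReal) (fun s ω => F s (picardIterate t₀ F (g ω) k s)) t ht.1 (fun ω => ?_)
      fun s hs => ?_)
    · exact (hF.comp (continuous_id.prodMk (continuous_picardIterate hF (hg ω) k))).continuousOn
    · have h1 : Continuous (F s) := hF.comp (continuous_const.prodMk continuous_id)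
      exact h1.measurable.comp ((ih s ⟨hs.1, hs.2.trans ht.2⟩).mono
        (𝔽.mono (Real.toNNReal_le_toNNReal hs.2)) le_rfl)

end Measurability

end CARAGame

namespace CARAGame

/-! ### Coordinate norms and the Gronwall bound for paths. -/

section Euclidean

variable {n : ℕ}

lemma norm_le_sum_abs (v : EuclideanSpace ℝ (Fin n)) : ‖v‖ ≤ ∑ k, |v k| := by
  rw [EuclideanSpace.norm_eq]
  refine Real.sqrt_le_iff.2 ⟨Finset.sum_nonneg fun _ _ => abs_nonneg _, ?_⟩
  simpa only [Real.norm_eq_abs] using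
    Finset.sum_sq_le_sq_sum_of_nonneg (s := Finset.univ) fun k _ => abs_nonneg (v k)

lemma abs_apply_le_norm (v : EuclideanSpace ℝ (Fin n)) (k : Fin n) : |v k| ≤ ‖v‖ :=
  PiLp.norm_apply_le v k

lemma continuousOn_apply {s : Set ℝ} {x : ℝ → EuclideanSpace ℝ (Fin n)} (hx : ContinuousOn x s)
    (k : Fin n) : ContinuousOn (fun t => x t k) s :=
  (EuclideanSpace.proj (𝕜 := ℝ) k).continuous.comp_continuousOn hx

end Euclidean

section Bounds

variable {n : ℕ} {t₀ T : ℝ}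

/-- Gronwall estimate for a path that solves an integral equation with a forcing term. -/
lemma sum_abs_le_of_integral_eq {x : ℝ → EuclideanSpace ℝ (Fin n)}
    (hx : ContinuousOn x (Set.Icc t₀ T)) {x₀ : Fin n → ℝ} {d y : Fin n → ℝ → ℝ} {a K m : ℝ}
    (ha : 0 ≤ a) (hK : 0 ≤ K) (hm : 0 ≤ m)
    (heq : ∀ t ∈ Set.Icc t₀ T, ∀ i, x t i = x₀ i + (∫ s in t₀..t, d i s) + y i t)
    (hd : ∀ s ∈ Set.Icc t₀ T, ∀ i, |d i s| ≤ a + K * ∑ k, |x s k|)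
    (hy : ∀ t ∈ Set.Icc t₀ T, ∀ i, |y i t| ≤ m) {t : ℝ} (ht : t ∈ Set.Icc t₀ T) :
    ∑ k, |x t k| ≤
      (∑ i, |x₀ i| + n * (a * (T - t₀) + m)) * Real.exp (n * K * (T - t₀)) := by
  have hle : t₀ ≤ T := ht.1.trans ht.2
  have hφ : ContinuousOn (fun t => ∑ k, |x t k|) (Set.Icc t₀ T) :=
    continuousOn_finsetSum _ fun k _ => (continuousOn_apply hx k).abs
  have hτ := sub_nonneg.2 hle
  refine le_mul_exp_of_le_add_integral hφ
    (add_nonneg (Finset.sum_nonneg fun _ _ => abs_nonneg _) (by positivity)) (by positivity)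
    (fun t ht => ?_) ht
  have hφi : IntervalIntegrable (fun s => ∑ k, |x s k|) volume t₀ t := by
    refine ContinuousOn.intervalIntegrable ?_
    rw [Set.uIcc_of_le ht.1]
    exact hφ.mono (Set.Icc_subset_Icc_right ht.2)
  have hterm : ∀ i, |x t i| ≤ |x₀ i| + (a * (T - t₀) + m) + K * ∫ s in t₀..t, ∑ k, |x s k| := by
    intro i
    have hint_f : |∫ s in t₀..t, d i s| ≤ a * (t - t₀) + K * ∫ s in t₀..t, ∑ k, |x s k| := by
      have h1 : ‖∫ s in t₀..t, d i s‖ ≤ ∫ s in t₀..t, (a + K * ∑ k, |x s k|) :=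
        intervalIntegral.norm_integral_le_of_norm_le ht.1
          (ae_of_all _ fun s hs => hd s ⟨hs.1.le, hs.2.trans ht.2⟩ i)
          (intervalIntegrable_const.add (hφi.const_mul K))
      rw [intervalIntegral.integral_add intervalIntegrable_const (hφi.const_mul K),
        intervalIntegral.integral_const, intervalIntegral.integral_const_mul, smul_eq_mul,
        mul_comm (t - t₀)] at h1
      exact h1
    have h2 : a * (t - t₀) ≤ a * (T - t₀) :=
      mul_le_mul_of_nonneg_left (by linarith [ht.2]) ha
    rw [heq t ht i]
    have h3 := abs_add_le (x₀ i + ∫ s in t₀..t, d i s) (y i t)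
    have h4 := abs_add_le (x₀ i) (∫ s in t₀..t, d i s)
    have h5 := hy t ht i
    linarith
  refine (Finset.sum_le_sum fun i _ => hterm i).trans (le_of_eq ?_)
  simp only [Finset.sum_add_distrib, Finset.sum_const, Finset.card_univ, Fintype.card_fin,
    nsmul_eq_mul]
  ring

end Bounds

/-! ### Linear equations with additive noise. -/

section SDE

variable {Ω ι : Type*} {mΩ : MeasurableSpace Ω} {P : Measure Ω} [Fintype ι]
  {𝔽 : Filtration ℝ≥0 mΩ} {n : ℕ} {t₀ T : ℝ} {x₀ : EuclideanSpace ℝ (Fin n)}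

lemma IsItoIntegral.ae_eq_of_continuousOn [IsProbabilityMeasure P] {Z : ℝ≥0 → Ω → ℝ}
    (hZ : IsBrownianFor P 𝔽 Z) (ht₀ : 0 ≤ t₀) (h : t₀ ≤ T) {f : ℝ → ℝ}
    (hf : ContinuousOn f (Set.Icc t₀ T)) {I J : ℝ → Ω → ℝ}
    (hI : IsItoIntegral P 𝔽 t₀ T Z (fun t _ => f t) I)
    (hJ : IsItoIntegral P 𝔽 t₀ T Z (fun t _ => f t) J) :
    ∀ᵐ ω ∂P, ∀ t ∈ Set.Icc t₀ T, I t ω = J t ω := by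
  -- Uniqueness asks for an integrand measurable on all of `ℝ`; the integral depends only on the
  -- values on `[t₀, T]`.
  set f' : ℝ → ℝ := Set.IccExtend h ((Set.Icc t₀ T).domRestrict f) with hf'
  have hf'c : Continuous f' :=
    (continuousOn_iff_continuous_domRestrict.1 hf).Icc_extend'
  have e : ∀ s ∈ Set.Icc t₀ T, (fun _ : Ω => f s) = fun _ => f' s := fun s hs => by
    rw [hf', Set.IccExtend_of_mem _ _ hs]; rfl
  exact (hI.congr (H' := fun s _ => f' s) e).ae_eq hZ ht₀ (hf'c.measurable.comp measurable_fst)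
    (hJ.congr (H' := fun s _ => f' s) e)

/-- Any version agrees almost surely, at all times, with the constructed one and inherits its
maximal bound. -/
lemma IsItoIntegral.exists_hasExpMoments [IsProbabilityMeasure P] {Z : ℝ≥0 → Ω → ℝ}
    (hZ : IsBrownianFor P 𝔽 Z) (ht₀ : 0 ≤ t₀) (h : t₀ < T) {f : ℝ → ℝ}
    (hf : ContinuousOn f (Set.Icc t₀ T)) {I : ℝ → Ω → ℝ}
    (hI : IsItoIntegral P 𝔽 t₀ T Z (fun t _ => f t) I) :
    ∃ M : Ω → ℝ, HasExpMoments P M ∧ ∀ᵐ ω ∂P, ∀ t ∈ Set.Icc t₀ T, |I t ω| ≤ M ω := by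
  obtain ⟨J, hJ, V, hV⟩ := hZ.exists_isItoIntegral ht₀ h hf
  obtain ⟨M, hM, hle⟩ := exists_hasExpMoments_of_tail h.le hJ.2.1.2 hV
  refine ⟨M, hM, ?_⟩
  filter_upwards [hI.ae_eq_of_continuousOn hZ ht₀ h.le hf hJ] with ω hω t ht
  rw [hω t ht]
  exact hle ω t ht

variable {Z : ι → ℝ≥0 → Ω → ℝ}

lemma IsItoProcess.congr {drift drift' : Fin n → ℝ → Ω → ℝ} {diff diff' : Fin n → ι → ℝ → Ω → ℝ}
    {X : ℝ → Ω → EuclideanSpace ℝ (Fin n)}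
    (hdrift : ∀ i, ∀ t ∈ Set.Icc t₀ T, drift i t = drift' i t)
    (hdiff : ∀ i j, ∀ t ∈ Set.Icc t₀ T, diff i j t = diff' i j t)
    (hX : IsItoProcess P 𝔽 Z t₀ T x₀ drift diff X) :
    IsItoProcess P 𝔽 Z t₀ T x₀ drift' diff' X := by
  obtain ⟨hc, hint_f, I, hI, heq⟩ := hX
  refine ⟨hc, fun i => ?_, I, fun i j => (hI i j).congr (hdiff i j), ?_⟩
  · filter_upwards [hint_f i] with ω hω
    exact hω.congr_fun (fun s hs => by simp only [hdrift i s hs]) measurableSet_Icc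
  · filter_upwards [heq] with ω hω t ht i
    rw [hω t ht i]
    congr 2
    refine intervalIntegral.integral_congr fun s hs => ?_
    rw [Set.uIcc_of_le ht.1] at hs
    simp only [hdrift i s ⟨hs.1, hs.2.trans ht.2⟩]

/-- An Itô process is determined by its drift and a deterministic continuous diffusion
coefficient. -/
lemma IsItoProcess.ae_eq [IsProbabilityMeasure P] (hZ : ∀ j, IsBrownianFor P 𝔽 (Z j))
    (ht₀ : 0 ≤ t₀) (h : t₀ ≤ T) {drift : Fin n → ℝ → Ω → ℝ} {D : Fin n → ι → ℝ → ℝ}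
    (hD : ∀ i j, ContinuousOn (D i j) (Set.Icc t₀ T)) {X Y : ℝ → Ω → EuclideanSpace ℝ (Fin n)}
    (hX : IsItoProcess P 𝔽 Z t₀ T x₀ drift (fun i j t _ => D i j t) X)
    (hY : IsItoProcess P 𝔽 Z t₀ T x₀ drift (fun i j t _ => D i j t) Y) :
    ∀ᵐ ω ∂P, ∀ t ∈ Set.Icc t₀ T, X t ω = Y t ω := by
  obtain ⟨-, -, I, hI, hXeq⟩ := hX
  obtain ⟨-, -, J, hJ, hYeq⟩ := hY
  have hIJ : ∀ᵐ ω ∂P, ∀ i j, ∀ t ∈ Set.Icc t₀ T, I i j t ω = J i j t ω :=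
    ae_all_iff.2 fun i => ae_all_iff.2 fun j =>
      (hI i j).ae_eq_of_continuousOn (hZ j) ht₀ h (hD i j) (hJ i j)
  filter_upwards [hXeq, hYeq, hIJ] with ω h1 h2 h3 t ht
  ext i
  rw [h1 t ht i, h2 t ht i, Finset.sum_congr rfl fun j _ => h3 i j t ht]

variable {A : ℝ → Matrix (Fin n) (Fin n) ℝ} {b : ℝ → Fin n → ℝ} {D : ℝ → Matrix (Fin n) ι ℝ}

/-- The drift of a linear equation. -/
abbrev linearDrift (A : ℝ → Matrix (Fin n) (Fin n) ℝ) (b : ℝ → Fin n → ℝ) (i : Fin n) (t : ℝ)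
    (x : EuclideanSpace ℝ (Fin n)) : ℝ := ∑ k, A t i k * x k + b t i

lemma exists_bound_coeff (hA : ContinuousOn A (Set.Icc t₀ T)) (hb : ContinuousOn b (Set.Icc t₀ T)) :
    ∃ K, 0 ≤ K ∧ ∀ t ∈ Set.Icc t₀ T, (∀ i k, |A t i k| ≤ K) ∧ ∀ i, |b t i| ≤ K := by
  have hAc : ∀ i k, ContinuousOn (fun t => A t i k) (Set.Icc t₀ T) := fun i k =>
    continuousOn_pi.1 (continuousOn_pi.1 hA i) k
  have hc : ContinuousOn (fun t => (∑ i, ∑ k, |A t i k|) + ∑ i, |b t i|) (Set.Icc t₀ T) :=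
    (continuousOn_finsetSum _ fun i _ => continuousOn_finsetSum _ fun k _ => (hAc i k).abs).add
      (continuousOn_finsetSum _ fun i _ => (continuousOn_pi.1 hb i).abs)
  obtain ⟨K, hK⟩ := isCompact_Icc.exists_bound_of_continuousOn hc
  have h1 : ∀ t, 0 ≤ ∑ i, ∑ k, |A t i k| := fun t =>
    Finset.sum_nonneg fun _ _ => Finset.sum_nonneg fun _ _ => abs_nonneg _
  have h2 : ∀ t, 0 ≤ ∑ i, |b t i| := fun t => Finset.sum_nonneg fun _ _ => abs_nonneg _
  refine ⟨|K|, abs_nonneg K, fun t ht => ⟨fun i k => ?_, fun i => ?_⟩⟩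
  · have h3 : |A t i k| ≤ ∑ i, ∑ k, |A t i k| :=
      (Finset.single_le_sum (f := fun k => |A t i k|) (fun _ _ => abs_nonneg _)
        (Finset.mem_univ k)).trans
      (Finset.single_le_sum (f := fun i => ∑ k, |A t i k|)
        (fun _ _ => Finset.sum_nonneg fun _ _ => abs_nonneg _) (Finset.mem_univ i))
    have h4 := hK t ht
    rw [Real.norm_eq_abs, abs_of_nonneg (add_nonneg (h1 t) (h2 t))] at h4
    linarith [h2 t, le_abs_self K]
  · have h3 : |b t i| ≤ ∑ i, |b t i| :=
      Finset.single_le_sum (f := fun i => |b t i|) (fun _ _ => abs_nonneg _) (Finset.mem_univ i)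
    have h4 := hK t ht
    rw [Real.norm_eq_abs, abs_of_nonneg (add_nonneg (h1 t) (h2 t))] at h4
    linarith [h1 t, le_abs_self K]

lemma abs_sum_mul_le {K : ℝ} {a : Fin n → ℝ} (ha : ∀ k, |a k| ≤ K) (x : Fin n → ℝ) :
    |∑ k, a k * x k| ≤ K * ∑ k, |x k| := by
  rw [Finset.mul_sum]
  refine (Finset.abs_sum_le_sum_abs _ _).trans (Finset.sum_le_sum fun k _ => ?_)
  rw [abs_mul]
  exact mul_le_mul_of_nonneg_right (ha k) (abs_nonneg _)

/-- Pathwise Gronwall bounds the state by an affine function of the maxima of the noise integrals,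
and exponential moments survive sums and increasing affine maps. -/
theorem linearSDE_exists_hasExpMoments [IsProbabilityMeasure P]
    (hZ : ∀ j, IsBrownianFor P 𝔽 (Z j)) (ht₀ : 0 ≤ t₀) (h : t₀ < T)
    (hA : ContinuousOn A (Set.Icc t₀ T)) (hb : ContinuousOn b (Set.Icc t₀ T))
    (hD : ContinuousOn D (Set.Icc t₀ T)) {X : ℝ → Ω → EuclideanSpace ℝ (Fin n)}
    (hX : IsSDESolution P 𝔽 Z t₀ T x₀ (linearDrift A b) (fun i j t _ => D t i j) X) :
    ∃ M : Ω → ℝ, HasExpMoments P M ∧ (∀ᵐ ω ∂P, ∀ t ∈ Set.Icc t₀ T, ∑ k, |X t ω k| ≤ M ω) := by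
  obtain ⟨hc, -, I, hI, heq⟩ := hX
  obtain ⟨K, hK0, hK⟩ := exists_bound_coeff hA hb
  have hDc : ∀ i j, ContinuousOn (fun t => D t i j) (Set.Icc t₀ T) := fun i j =>
    continuousOn_pi.1 (continuousOn_pi.1 hD i) j
  choose M hM hIM using fun i j => (hI i j).exists_hasExpMoments (hZ j) ht₀ h (hDc i j)
  have hIM' : ∀ᵐ ω ∂P, ∀ i j, ∀ t ∈ Set.Icc t₀ T, |I i j t ω| ≤ M i j ω :=
    ae_all_iff.2 fun i => ae_all_iff.2 fun j => hIM i j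
  have hsum : HasExpMoments P fun ω => ∑ i, ∑ j, M i j ω :=
    hasExpMoments_sum _ fun i => hasExpMoments_sum _ fun j => hM i j
  set e := Real.exp (n * K * (T - t₀)) with he
  refine ⟨_, hsum.const_add_mul ((∑ i, |x₀ i| + n * (K * (T - t₀))) * e) (b := n * e)
    (by positivity), ?_⟩
  filter_upwards [heq, hIM'] with ω h1 h2 t ht
  have hM0 : ∀ i j, 0 ≤ M i j ω := fun i j => (abs_nonneg _).trans (h2 i j t ht)
  have hy : ∀ s ∈ Set.Icc t₀ T, ∀ i, |∑ j, I i j s ω| ≤ ∑ i, ∑ j, M i j ω := by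
    intro s hs i
    refine (Finset.abs_sum_le_sum_abs _ _).trans
      ((Finset.sum_le_sum fun j _ => h2 i j s hs).trans ?_)
    exact Finset.single_le_sum (f := fun i => ∑ j, M i j ω)
      (fun i _ => Finset.sum_nonneg fun j _ => hM0 i j) (Finset.mem_univ i)
  have := sum_abs_le_of_integral_eq (hc.2 ω) hK0 hK0
    (Finset.sum_nonneg fun i _ => Finset.sum_nonneg fun j _ => hM0 i j)
    (d := fun i s => linearDrift A b i s (X s ω)) (y := fun i t => ∑ j, I i j t ω) h1
    (fun s hs i => ?_) hy ht
  · refine this.trans (le_of_eq ?_)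
    rw [← he]
    ring
  · refine (abs_add_le _ _).trans ?_
    have h3 := abs_sum_mul_le ((hK s hs).1 i) (X s ω)
    have h4 := (hK s hs).2 i
    linarith

/-- The additive noise cancels in `X - Y`, which solves a homogeneous linear equation from zero. -/
theorem linearSDE_ae_eq [IsProbabilityMeasure P]
    (hZ : ∀ j, IsBrownianFor P 𝔽 (Z j)) (ht₀ : 0 ≤ t₀) (h : t₀ ≤ T)
    (hA : ContinuousOn A (Set.Icc t₀ T)) (hb : ContinuousOn b (Set.Icc t₀ T))
    (hD : ContinuousOn D (Set.Icc t₀ T)) {X Y : ℝ → Ω → EuclideanSpace ℝ (Fin n)}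
    (hX : IsSDESolution P 𝔽 Z t₀ T x₀ (linearDrift A b) (fun i j t _ => D t i j) X)
    (hY : IsSDESolution P 𝔽 Z t₀ T x₀ (linearDrift A b) (fun i j t _ => D t i j) Y) :
    ∀ᵐ ω ∂P, ∀ t ∈ Set.Icc t₀ T, X t ω = Y t ω := by
  obtain ⟨hXc, hXi, I, hI, hXeq⟩ := hX
  obtain ⟨hYc, hYi, J, hJ, hYeq⟩ := hY
  obtain ⟨K, hK0, hK⟩ := exists_bound_coeff hA hb
  have hDc : ∀ i j, ContinuousOn (fun t => D t i j) (Set.Icc t₀ T) := fun i j =>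
    continuousOn_pi.1 (continuousOn_pi.1 hD i) j
  have hIJ : ∀ᵐ ω ∂P, ∀ i j, ∀ t ∈ Set.Icc t₀ T, I i j t ω = J i j t ω :=
    ae_all_iff.2 fun i => ae_all_iff.2 fun j =>
      (hI i j).ae_eq_of_continuousOn (hZ j) ht₀ h (hDc i j) (hJ i j)
  filter_upwards [hXeq, hYeq, hIJ, ae_all_iff.2 hXi, ae_all_iff.2 hYi] with ω h1 h2 h3 h4 h5 t ht
  have hii : ∀ {f : ℝ → ℝ} {s : ℝ}, IntegrableOn f (Set.Icc t₀ T) → s ∈ Set.Icc t₀ T →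
      IntervalIntegrable f volume t₀ s := fun hf hs =>
    (intervalIntegrable_iff_integrableOn_Icc_of_le hs.1).2
      (hf.mono_set (Set.Icc_subset_Icc_right hs.2))
  have := sum_abs_le_of_integral_eq (x := fun s => X s ω - Y s ω) ((hXc.2 ω).sub (hYc.2 ω))
    (x₀ := 0) (a := 0) (K := K) (m := 0) le_rfl hK0 le_rfl
    (d := fun i s => linearDrift A b i s (X s ω) - linearDrift A b i s (Y s ω))
    (y := fun _ _ => 0) (fun s hs i => ?_) (fun s hs i => ?_) (fun _ _ _ => by simp) ht
  · have hz : ∑ k, |(X t ω - Y t ω) k| ≤ 0 := by simpa using this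
    have := (norm_le_sum_abs _).trans hz
    exact sub_eq_zero.1 (norm_le_zero_iff.1 this)
  · rw [intervalIntegral.integral_sub (hii (h4 i) hs) (hii (h5 i) hs), PiLp.sub_apply, h1 s hs i,
      h2 s hs i, Finset.sum_congr rfl fun j _ => h3 i j s hs]
    simp only [Pi.zero_apply]
    ring
  · have e : linearDrift A b i s (X s ω) - linearDrift A b i s (Y s ω) =
        ∑ k, A s i k * (X s ω - Y s ω) k := by
      simp only [linearDrift, PiLp.sub_apply, mul_sub, Finset.sum_sub_distrib]
      ring
    rw [e, zero_add]
    exact abs_sum_mul_le ((hK s hs).1 i) _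

/-- The noise integrals are a continuous forcing term for every `ω`, so the equation is solved path
by path; adaptedness passes to the limit of the Picard iterates. -/
theorem linearSDE_exists [IsProbabilityMeasure P]
    (hZ : ∀ j, IsBrownianFor P 𝔽 (Z j)) (ht₀ : 0 ≤ t₀) (h : t₀ < T)
    (hA : ContinuousOn A (Set.Icc t₀ T)) (hb : ContinuousOn b (Set.Icc t₀ T))
    (hD : ContinuousOn D (Set.Icc t₀ T)) :
    ∃ X : ℝ → Ω → EuclideanSpace ℝ (Fin n),
      IsSDESolution P 𝔽 Z t₀ T x₀ (linearDrift A b) (fun i j t _ => D t i j) X := by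
  have hDc : ∀ i j, ContinuousOn (fun t => D t i j) (Set.Icc t₀ T) := fun i j =>
    continuousOn_pi.1 (continuousOn_pi.1 hD i) j
  choose I hI _ _ using fun i j => (hZ j).exists_isItoIntegral ht₀ h (hDc i j)
  obtain ⟨K, hK0, hK⟩ := exists_bound_coeff hA hb
  -- Freezing time outside `[t₀, T]` makes coefficients and forcing continuous on `ℝ`, as the
  -- iteration requires.
  set pr : ℝ → ℝ := fun t => (Set.projIcc t₀ T h.le t : ℝ) with hpr
  have hprc : Continuous pr := continuous_subtype_val.comp continuous_projIcc
  have hprm : ∀ t, pr t ∈ Set.Icc t₀ T := fun t => (Set.projIcc t₀ T h.le t).2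
  have hpre : ∀ t ∈ Set.Icc t₀ T, pr t = t := fun t ht => by
    simp only [hpr, Set.projIcc_of_mem h.le ht]
  have hAc : ∀ i k, Continuous fun t => A (pr t) i k := fun i k =>
    (continuousOn_pi.1 (continuousOn_pi.1 hA i) k).comp_continuous hprc hprm
  have hbc : ∀ i, Continuous fun t => b (pr t) i := fun i =>
    (continuousOn_pi.1 hb i).comp_continuous hprc hprm
  set F : ℝ → EuclideanSpace ℝ (Fin n) → EuclideanSpace ℝ (Fin n) := fun s x =>
    WithLp.toLp 2 fun i => linearDrift A b i (pr s) x with hF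
  have hFc : Continuous fun p : ℝ × EuclideanSpace ℝ (Fin n) => F p.1 p.2 := by
    refine (PiLp.continuous_toLp 2 _).comp (continuous_pi fun i => ?_)
    refine (continuous_finsetSum _ fun k _ => ((hAc i k).comp continuous_fst).mul ?_).add
      ((hbc i).comp continuous_fst)
    exact (EuclideanSpace.proj (𝕜 := ℝ) k).continuous.comp continuous_snd
  -- The `+ 1` keeps the Lipschitz constant positive when `n` or `K` is zero.
  have hFL : ∀ s x y, ‖F s x - F s y‖ ≤ (n * (K * n) + 1) * ‖x - y‖ := by
    intro s x y
    refine (norm_le_sum_abs _).trans ?_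
    have hi : ∀ i, |(F s x - F s y) i| ≤ K * n * ‖x - y‖ := by
      intro i
      have e : (F s x - F s y) i = ∑ k, A (pr s) i k * (x - y) k := by
        simp only [hF, linearDrift, PiLp.sub_apply, mul_sub, Finset.sum_sub_distrib]
        ring
      rw [e]
      refine (abs_sum_mul_le ((hK _ (hprm s)).1 i) _).trans ?_
      rw [mul_assoc]
      refine mul_le_mul_of_nonneg_left ?_ hK0
      refine (Finset.sum_le_sum fun k _ => abs_apply_le_norm (x - y) k).trans ?_
      simp
    refine (Finset.sum_le_sum fun i _ => hi i).trans ?_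
    simp only [Finset.sum_const, Finset.card_univ, Fintype.card_fin, nsmul_eq_mul]
    nlinarith [norm_nonneg (x - y)]
  set g : Ω → ℝ → EuclideanSpace ℝ (Fin n) := fun ω t =>
    WithLp.toLp 2 fun i => x₀ i + ∑ j, I i j (pr t) ω with hg
  have hgc : ∀ ω, Continuous (g ω) := fun ω => by
    refine (PiLp.continuous_toLp 2 _).comp (continuous_pi fun i => ?_)
    exact continuous_const.add (continuous_finsetSum _ fun j _ =>
      ((hI i j).2.1.2 ω).comp_continuous hprc hprm)
  have hgm : ∀ t ∈ Set.Icc t₀ T, Measurable[𝔽 t.toNNReal] fun ω => g ω t := fun t ht => by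
    refine (PiLp.continuous_toLp 2 _).measurable.comp
      (@measurable_pi_lambda _ _ _ (𝔽 t.toNNReal) _ _ fun i => ?_)
    refine measurable_const.add (Finset.measurable_fun_sum _ fun j _ => ?_)
    rw [hpre t ht]
    exact (hI i j).2.1.1 t ht
  have hKpos : 0 < n * (K * n) + 1 := by positivity
  choose x hxu hxc hxe using fun ω =>
    exists_tendstoUniformlyOn_picardIterate h.le hFc (hgc ω) hKpos hFL
  refine ⟨fun t ω => x ω t, ⟨fun t ht => ?_, hxc⟩, fun i => ae_of_all _ fun ω => ?_, I, hI,
    ae_of_all _ fun ω t ht i => ?_⟩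
  · refine @measurable_of_tendsto_metrizable Ω _ (𝔽 t.toNNReal) _ _ _ _
      (fun k ω => picardIterate t₀ F (g ω) k t) _
      (fun k => measurable_picardIterate hFc hgc hgm k t ht) ?_
    rw [tendsto_pi_nhds]
    exact fun ω => (hxu ω).tendsto_at ht
  · refine ContinuousOn.integrableOn_Icc ?_
    refine (continuousOn_finsetSum _ fun k _ => ?_).add (continuousOn_pi.1 hb i)
    exact (continuousOn_pi.1 (continuousOn_pi.1 hA i) k).mul (continuousOn_apply (hxc ω) k)
  · have hint_f : IntervalIntegrable (fun s => F s (x ω s)) volume t₀ t := by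
      refine ContinuousOn.intervalIntegrable ?_
      rw [Set.uIcc_of_le ht.1]
      exact (hFc.comp_continuousOn (continuousOn_id.prodMk (hxc ω))).mono
        (Set.Icc_subset_Icc_right ht.2)
    have e := (EuclideanSpace.proj (𝕜 := ℝ) i).intervalIntegral_comp_comm hint_f
    have e' : (∫ s in t₀..t, F s (x ω s)) i = ∫ s in t₀..t, linearDrift A b i s (x ω s) := by
      refine e.symm.trans (intervalIntegral.integral_congr fun s hs => ?_)
      rw [Set.uIcc_of_le ht.1] at hs
      simp only [hF, hpre s ⟨hs.1, hs.2.trans ht.2⟩]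
      rfl
    have e'' := congrArg (fun v => v i) (hxe ω t ht)
    simp only [PiLp.add_apply, e', hg, hpre t ht] at e''
    refine e''.trans ?_
    ring

end SDE

end CARAGame

namespace CARAGame

/-! ### Domination by exponential moments. -/

section Domination

variable {Ω : Type*} {mΩ : MeasurableSpace Ω} {P : Measure Ω} {M : Ω → ℝ}

lemma HasExpMoments.lintegral_lt_top (hM : HasExpMoments P M) {c : ℝ} (hc : 0 ≤ c) {C : ℝ≥0∞}
    (hC : C ≠ ∞) {F : Ω → ℝ≥0∞} (hF : ∀ᵐ ω ∂P, F ω ≤ C * ENNReal.ofReal (Real.exp (c * M ω))) :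
    ∫⁻ ω, F ω ∂P < ∞ := by
  obtain ⟨G, hGm, hG, hle⟩ := hM c hc
  refine lt_of_le_of_lt (lintegral_mono_ae (g := fun ω => C * G ω) ?_) ?_
  · filter_upwards [hF] with ω hω
    exact hω.trans (mul_le_mul_right (hle ω) C)
  · rw [lintegral_const_mul _ hGm]
    exact ENNReal.mul_lt_top hC.lt_top hG

/-- A single integrable function is uniformly integrable as a constant family, and this passes to
every family it dominates. -/
lemma HasExpMoments.uniformIntegrable (hM : HasExpMoments P M) {c : ℝ} (hc : 0 ≤ c)
    {ι : Type*} {f : ι → Ω → ℝ} (hf : ∀ i, AEStronglyMeasurable (f i) P)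
    (hle : ∀ i, ∀ᵐ ω ∂P, |f i ω| ≤ Real.exp (c * M ω)) : UniformIntegrable f 1 P := by
  obtain ⟨G, hGm, hG, hGle⟩ := hM c hc
  have hg : MemLp (fun ω => (G ω).toReal) 1 P :=
    memLp_one_iff_integrable.2 (integrable_toReal_of_lintegral_ne_top hGm.aemeasurable hG.ne)
  have hfg : ∀ i, ∀ᵐ ω ∂P, ‖f i ω‖ ≤ ‖(G ω).toReal‖ := fun i => by
    filter_upwards [hle i, ae_lt_top hGm hG.ne] with ω h1 h2
    rw [Real.norm_eq_abs, Real.norm_eq_abs, abs_of_nonneg ENNReal.toReal_nonneg]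
    refine h1.trans ?_
    rw [← ENNReal.toReal_ofReal (Real.exp_pos (c * M ω)).le]
    exact ENNReal.toReal_mono h2.ne (hGle ω)
  obtain ⟨-, hUI, C, hC⟩ := uniformIntegrable_const (ι := ι) le_rfl ENNReal.one_ne_top hg
  refine ⟨hf, fun ε hε => ?_, C, fun i => (eLpNorm_mono_ae (hfg i)).trans (hC i)⟩
  obtain ⟨δ, hδ, h⟩ := hUI hε
  refine ⟨δ, hδ, fun i s hs hsδ => le_trans (eLpNorm_mono_ae ?_) (h i s hs hsδ)⟩
  filter_upwards [hfg i] with ω hω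
  by_cases hωs : ω ∈ s
  · simpa only [Set.indicator_of_mem hωs] using hω
  · simp only [Set.indicator_of_notMem hωs, le_refl]

lemma enorm_sq_le_ofReal_exp {E : Type*} [SeminormedAddCommGroup E] {v : E} {m : ℝ}
    (h : ‖v‖ ≤ m) : ‖v‖ₑ ^ 2 ≤ ENNReal.ofReal (Real.exp (2 * m)) := by
  rw [← ofReal_norm, ← ENNReal.ofReal_pow (norm_nonneg v)]
  refine ENNReal.ofReal_le_ofReal ?_
  have h1 : ‖v‖ ≤ Real.exp m := h.trans (by linarith [Real.add_one_le_exp m])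
  calc ‖v‖ ^ 2 ≤ Real.exp m ^ 2 := by gcongr
    _ = Real.exp (2 * m) := by rw [← Real.exp_nat_mul]; norm_num

end Domination

/-! ### Exponential bounds for the utilities. -/

section Utility

variable {n : ℕ} (κ : Params n)

lemma abs_othersMean_le (i : Fin n) (v : Fin n → ℝ) : |othersMean i v| ≤ ∑ k, |v k| := by
  have hn : (1 : ℝ) ≤ n := by exact_mod_cast Nat.one_le_iff_ne_zero.2 (Fin.pos i).ne'
  unfold othersMean
  rw [abs_mul, abs_of_nonneg (by positivity)]
  have h1 : 1 / (n : ℝ) ≤ 1 := by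
    rw [div_le_one (by linarith)]; exact hn
  calc 1 / (n : ℝ) * |∑ k ∈ Finset.univ.erase i, v k| ≤ 1 * |∑ k ∈ Finset.univ.erase i, v k| := by
        gcongr
    _ ≤ ∑ k ∈ Finset.univ.erase i, |v k| := by
        rw [one_mul]; exact Finset.abs_sum_le_sum_abs _ _
    _ ≤ ∑ k, |v k| := Finset.sum_le_sum_of_subset_of_nonneg (Finset.erase_subset _ _)
        fun _ _ _ => abs_nonneg _

/-- The exponent is linear in `v`, hence at most a multiple of `∑ k, |v k|`; squaring doubles the
rate. One bound serves wealth and consumption alike. -/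
lemma exists_enorm_utility_sq_le (i : Fin n) :
    ∃ L : ℝ, 0 ≤ L ∧ ∀ (v : Fin n → ℝ) (m : ℝ), ∑ k, |v k| ≤ m →
      ‖κ.utility i (v i) (othersMean i v)‖ₑ ^ 2 ≤ ENNReal.ofReal (Real.exp (L * m)) := by
  set a := -(1 / κ.δ i) * (1 - κ.θ i / n) with ha
  set b := κ.θ i / κ.δ i with hb
  refine ⟨2 * (|a| + |b|), by positivity, fun v m hm => ?_⟩
  have h1 : a * v i ≤ |a| * m := by
    refine (le_abs_self _).trans ?_
    rw [abs_mul]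
    exact mul_le_mul_of_nonneg_left ((Finset.single_le_sum (f := fun k => |v k|)
      (fun _ _ => abs_nonneg _) (Finset.mem_univ i)).trans hm) (abs_nonneg a)
  have h2 : b * othersMean i v ≤ |b| * m := by
    refine (le_abs_self _).trans ?_
    rw [abs_mul]
    exact mul_le_mul_of_nonneg_left ((abs_othersMean_le i v).trans hm) (abs_nonneg b)
  unfold Params.utility
  rw [enorm_neg, Real.enorm_eq_ofReal (Real.exp_pos _).le,
    ← ENNReal.ofReal_pow (Real.exp_pos _).le, ← Real.exp_nat_mul]
  refine ENNReal.ofReal_le_ofReal (Real.exp_le_exp.2 ?_)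
  push_cast
  rw [← ha, ← hb]
  linarith

lemma measurable_utility (i : Fin n) : Measurable fun v : EuclideanSpace ℝ (Fin n) =>
    κ.utility i (v i) (othersMean i fun k => v k) := by
  unfold Params.utility othersMean
  have h : ∀ k, Continuous fun v : EuclideanSpace ℝ (Fin n) => v k := fun k =>
    (EuclideanSpace.proj (𝕜 := ℝ) k).continuous
  exact (by fun_prop : Continuous _).measurable

end Utility

/-! ### Linear form of the closed-loop system. -/

section ClosedLoop

variable {n : ℕ} {κ : Params n} {T : ℝ} {Pol : Fin n → ℝ → ℝ}
  {Con : Fin n → ℝ → EuclideanSpace ℝ (Fin n) → ℝ}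

lemma IsDFStrategy.exists_consumption_coeff (hDF : IsDFStrategy T Pol Con) :
    ∃ (p : ℝ → Matrix (Fin n) (Fin n) ℝ) (q : ℝ → Fin n → ℝ),
      ContinuousOn p (Set.Icc 0 T) ∧ ContinuousOn q (Set.Icc 0 T) ∧
      ∀ t ∈ Set.Icc 0 T, ∀ x i, Con i t x = linearDrift p q i t x := by
  choose hPol p q hp hq hCon using hDF
  exact ⟨fun t i k => p i k t, fun t i => q i t,
    continuousOn_pi.2 fun i => continuousOn_pi.2 fun k => hp i k, continuousOn_pi.2 hq,
    fun t ht x i => hCon i t ht x⟩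

lemma Params.continuous_loading (κ : Params n) (i : Fin n) (j : Option (Fin n)) :
    Continuous fun p => κ.loading i p j := by
  cases j with
  | none => exact continuous_id.mul continuous_const
  | some k =>
    simp only [Params.loading]
    split_ifs
    · exact continuous_id.mul continuous_const
    · exact continuous_const

lemma IsDFStrategy.exists_linear (κ : Params n) (hDF : IsDFStrategy T Pol Con) :
    ∃ (A : ℝ → Matrix (Fin n) (Fin n) ℝ) (b : ℝ → Fin n → ℝ)
        (D : ℝ → Matrix (Fin n) (Option (Fin n)) ℝ),
      ContinuousOn A (Set.Icc 0 T) ∧ ContinuousOn b (Set.Icc 0 T) ∧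
      ContinuousOn D (Set.Icc 0 T) ∧
      ∀ t ∈ Set.Icc 0 T, ∀ (x : EuclideanSpace ℝ (Fin n)) (i : Fin n),
        closedLoopDrift κ Pol Con i t x = linearDrift A b i t x ∧
        ∀ j, closedLoopDiff κ Pol i j t x = D t i j := by
  obtain ⟨p, q, hp, hq, hCon⟩ := hDF.exists_consumption_coeff
  refine ⟨fun t => -p t, fun t i => Pol i t * κ.μ i - q t i, fun t i j => κ.loading i (Pol i t) j,
    hp.neg, continuousOn_pi.2 fun i => ((hDF i).1.mul continuousOn_const).sub
      (continuousOn_pi.1 hq i), continuousOn_pi.2 fun i => continuousOn_pi.2 fun j =>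
      (κ.continuous_loading i j).comp_continuousOn (hDF i).1, fun t ht x i => ⟨?_, fun j => rfl⟩⟩
  simp only [closedLoopDrift, hCon t ht x i, linearDrift, Matrix.neg_apply, neg_mul,
    Finset.sum_neg_distrib]
  ring

end ClosedLoop

end CARAGame

/-! ### The main theorem. -/

open CARAGame in
theorem mainTheorem5 {Ω : Type*} [MeasurableSpace Ω] (P : MeasureTheory.Measure Ω)
    [MeasureTheory.IsProbabilityMeasure P] (n : ℕ) (κ : CARAGame.Params n)
    (W : Fin n → ℝ≥0 → Ω → ℝ) (B : ℝ≥0 → Ω → ℝ)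
    (hWB : CARAGame.IsBrownianFamily P (CARAGame.noise W B))
    (𝔽 : MeasureTheory.Filtration ℝ≥0 ‹MeasurableSpace Ω›)
    (h𝔽 : 𝔽 = CARAGame.generatedFiltration P (CARAGame.noise W B) hWB.measurable)
    (T : ℝ) (Pol : Fin n → ℝ → ℝ) (Con : Fin n → ℝ → EuclideanSpace ℝ (Fin n) → ℝ)
    (hDF : CARAGame.IsDFStrategy T Pol Con)
    (t₀ : ℝ) (ht₀ : 0 ≤ t₀) (ht₀T : t₀ < T) (x₀ : EuclideanSpace ℝ (Fin n)) :
    -- the closed-loop system is a linear SDE with continuous deterministic coefficients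
    (∃ (A : ℝ → Matrix (Fin n) (Fin n) ℝ) (b : ℝ → Fin n → ℝ)
        (D : ℝ → Matrix (Fin n) (Option (Fin n)) ℝ),
      ContinuousOn A (Set.Icc 0 T) ∧ ContinuousOn b (Set.Icc 0 T) ∧
      ContinuousOn D (Set.Icc 0 T) ∧
      (∀ t ∈ Set.Icc 0 T, ∀ (x : EuclideanSpace ℝ (Fin n)) (i : Fin n),
        CARAGame.closedLoopDrift κ Pol Con i t x = ∑ k, A t i k * x k + b t i ∧
        ∀ j, CARAGame.closedLoopDiff κ Pol i j t x = D t i j) ∧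
      ∀ X : ℝ → Ω → EuclideanSpace ℝ (Fin n),
        CARAGame.IsClosedLoopSolution κ P 𝔽 W B t₀ T x₀ Pol Con X ↔
          CARAGame.IsLinearSDESolution P 𝔽 W B t₀ T x₀ A b D X) ∧
    -- it has a solution
    (∃ X : ℝ → Ω → EuclideanSpace ℝ (Fin n),
      CARAGame.IsClosedLoopSolution κ P 𝔽 W B t₀ T x₀ Pol Con X) ∧
    -- which is unique up to indistinguishability
    (∀ X Y : ℝ → Ω → EuclideanSpace ℝ (Fin n),
      CARAGame.IsClosedLoopSolution κ P 𝔽 W B t₀ T x₀ Pol Con X →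
      CARAGame.IsClosedLoopSolution κ P 𝔽 W B t₀ T x₀ Pol Con Y →
      ∀ᵐ ω ∂P, ∀ t ∈ Set.Icc t₀ T, X t ω = Y t ω) ∧
    ∀ X : ℝ → Ω → EuclideanSpace ℝ (Fin n),
      CARAGame.IsClosedLoopSolution κ P 𝔽 W B t₀ T x₀ Pol Con X →
      CARAGame.MemS2 P 𝔽 t₀ T X ∧
      -- the outcome is admissible, and `X` is its wealth process
      CARAGame.IsAdmissible P 𝔽 t₀ T (fun i t _ => Pol i t) (fun i t ω => Con i t (X t ω)) ∧
      CARAGame.IsWealth κ P 𝔽 W B t₀ T x₀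
        (fun i t _ => Pol i t) (fun i t ω => Con i t (X t ω)) X ∧
      -- exponentials of linear functionals of the state are uniformly integrable
      (∀ β : ℝ → Fin n → ℝ, ContinuousOn β (Set.Icc t₀ T) →
        MeasureTheory.UniformIntegrable
          (fun (t : Set.Icc t₀ T) ω => Real.exp (∑ k, β t k * X t ω k)) 1 P) ∧
      -- the square-integrability conditions on the utilities
      (∀ i, CARAGame.MemL2 P (𝔽 T.toNNReal) fun ω =>
        κ.utility i (X T ω i) (CARAGame.othersMean i fun k => X T ω k)) ∧
      CARAGame.IntegrabilityCondition κ P 𝔽 W B t₀ T x₀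
        (fun i t _ => Pol i t) (fun i t ω => Con i t (X t ω)) := by
  have hZ : ∀ j, IsBrownianFor P 𝔽 (noise W B j) := fun j => h𝔽 ▸ hWB.isBrownianFor j
  have hsub : Set.Icc t₀ T ⊆ Set.Icc 0 T := Set.Icc_subset_Icc_left ht₀
  obtain ⟨A, b, D, hA, hb, hD, hlin⟩ := hDF.exists_linear κ
  obtain ⟨p, q, hp, hq, hCon⟩ := hDF.exists_consumption_coeff
  have hiff : ∀ X : ℝ → Ω → EuclideanSpace ℝ (Fin n),
      IsClosedLoopSolution κ P 𝔽 W B t₀ T x₀ Pol Con X ↔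
        IsLinearSDESolution P 𝔽 W B t₀ T x₀ A b D X := fun X =>
    ⟨IsItoProcess.congr (fun i t ht => funext fun ω => (hlin t (hsub ht) (X t ω) i).1)
      (fun i j t ht => funext fun ω => (hlin t (hsub ht) (X t ω) i).2 j),
    IsItoProcess.congr (fun i t ht => funext fun ω => (hlin t (hsub ht) (X t ω) i).1.symm)
      (fun i j t ht => funext fun ω => ((hlin t (hsub ht) (X t ω) i).2 j).symm)⟩
  refine ⟨⟨A, b, D, hA, hb, hD, hlin, hiff⟩, ?_, fun X Y hX hY => ?_, fun X hX => ?_⟩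
  · obtain ⟨X, hX⟩ := linearSDE_exists (x₀ := x₀) hZ ht₀ ht₀T (hA.mono hsub) (hb.mono hsub)
      (hD.mono hsub)
    exact ⟨X, (hiff X).2 hX⟩
  · exact linearSDE_ae_eq hZ ht₀ ht₀T.le (hA.mono hsub) (hb.mono hsub) (hD.mono hsub)
      ((hiff X).1 hX) ((hiff Y).1 hY)
  have hXc : IsContinuousAdapted 𝔽 t₀ T X := hX.1
  -- a random variable with exponential moments that dominates the wealth and the consumption
  obtain ⟨M, hM, hXM, hcM⟩ : ∃ M : Ω → ℝ, HasExpMoments P M ∧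
      (∀ᵐ ω ∂P, ∀ t ∈ Set.Icc t₀ T, ∑ k, |X t ω k| ≤ M ω) ∧
      ∀ᵐ ω ∂P, ∀ t ∈ Set.Icc t₀ T, ∑ i, |Con i t (X t ω)| ≤ M ω := by
    obtain ⟨M, hM, hXM⟩ := linearSDE_exists_hasExpMoments hZ ht₀ ht₀T (hA.mono hsub)
      (hb.mono hsub) (hD.mono hsub) ((hiff X).1 hX)
    obtain ⟨K, hK0, hK⟩ := exists_bound_coeff (hp.mono hsub) (hq.mono hsub)
    -- Each consumption rate is at most `K * M + K`. Summing over the `n` agents and adding `M`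
    -- gives a bound for both quantities.
    refine ⟨fun ω => n * K + (1 + n * K) * M ω, hM.const_add_mul _ (by positivity), ?_, ?_⟩
    · filter_upwards [hXM] with ω hω t ht
      have h0 : 0 ≤ M ω := (Finset.sum_nonneg fun _ _ => abs_nonneg _).trans (hω t ht)
      have h1 : 0 ≤ n * K * M ω := by positivity
      have h2 : 0 ≤ n * K := by positivity
      linarith [hω t ht]
    · filter_upwards [hXM] with ω hω t ht
      have h0 : 0 ≤ M ω := (Finset.sum_nonneg fun _ _ => abs_nonneg _).trans (hω t ht)
      have h1 : ∀ i, |Con i t (X t ω)| ≤ K * M ω + K := fun i => by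
        rw [hCon t (hsub ht)]
        refine (abs_add_le _ _).trans (add_le_add ?_ ((hK t ht).2 i))
        exact (abs_sum_mul_le ((hK t ht).1 i) _).trans
          (mul_le_mul_of_nonneg_left (hω t ht) hK0)
      refine (Finset.sum_le_sum fun i _ => h1 i).trans ?_
      simp only [Finset.sum_const, Finset.card_univ, Fintype.card_fin, nsmul_eq_mul]
      linarith
  have hCc : ∀ i, IsContinuousAdapted 𝔽 t₀ T fun t ω => Con i t (X t ω) := fun i => by
    refine ⟨fun t ht => ?_, fun ω => ?_⟩
    · simp only [hCon t (hsub ht)]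
      refine (Finset.measurable_fun_sum _ fun k _ => Measurable.const_mul ?_ _).add
        measurable_const
      exact (EuclideanSpace.proj (𝕜 := ℝ) k).continuous.measurable.comp (hXc.1 t ht)
    · have hc : ContinuousOn (fun t => linearDrift p q i t (X t ω)) (Set.Icc t₀ T) :=
        (continuousOn_finsetSum _ fun k _ =>
          (continuousOn_pi.1 (continuousOn_pi.1 (hp.mono hsub) i) k).mul
            (continuousOn_apply (hXc.2 ω) k)).add (continuousOn_pi.1 (hq.mono hsub) i)
      exact hc.congr fun t ht => hCon t (hsub ht) _ i
  have htime : ∀ {f : ℝ → ℝ≥0∞} {C : ℝ≥0∞}, (∀ t ∈ Set.Icc t₀ T, f t ≤ C) →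
      ∫⁻ t in Set.Icc t₀ T, f t ≤ ENNReal.ofReal (T - t₀) * C := fun hf => by
    refine (setLIntegral_mono measurable_const hf).trans (le_of_eq ?_)
    rw [setLIntegral_const, Real.volume_Icc, mul_comm]
  have hadm : IsAdmissible P 𝔽 t₀ T (fun i t _ => Pol i t) (fun i t ω => Con i t (X t ω)) := by
    refine fun i => ⟨memH2_deterministic ((hDF i).1.mono hsub), (hCc i).isProgressiveOn, ?_⟩
    refine hM.lintegral_lt_top zero_le_two (C := ENNReal.ofReal (T - t₀)) ENNReal.ofReal_ne_top ?_
    filter_upwards [hcM] with ω hω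
    refine htime fun t ht => enorm_sq_le_ofReal_exp ((Finset.single_le_sum
      (f := fun i => |Con i t (X t ω)|) (fun _ _ => abs_nonneg _) (Finset.mem_univ i)).trans
      (hω t ht))
  have hTmem : T ∈ Set.Icc t₀ T := Set.right_mem_Icc.2 ht₀T.le
  -- By unfolding definitions, a closed-loop solution is the wealth process of its own outcome, so
  -- `hX` itself proves `IsWealth`.
  refine ⟨⟨hXc, ?_⟩, hadm, hX, fun β hβ => ?_, fun i => ?_, hadm, ⟨X, hX⟩, fun Y hY i => ?_⟩
  · refine hM.lintegral_lt_top zero_le_two ENNReal.one_ne_top ?_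
    filter_upwards [hXM] with ω hω
    rw [one_mul]
    exact iSup₂_le fun t ht => enorm_sq_le_ofReal_exp ((norm_le_sum_abs _).trans (hω t ht))
  · obtain ⟨K, hK⟩ := isCompact_Icc.exists_bound_of_continuousOn hβ
    refine hM.uniformIntegrable (c := |K|) (abs_nonneg K) (fun t => ?_) fun t => ?_
    · have hm : Measurable (X t) := (hXc.1 t t.2).mono (𝔽.le _) le_rfl
      refine (Real.measurable_exp.comp (Finset.measurable_fun_sum _ fun k _ =>
        Measurable.const_mul ?_ _)).aestronglyMeasurable
      exact (EuclideanSpace.proj (𝕜 := ℝ) k).continuous.measurable.comp hm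
    · filter_upwards [hXM] with ω hω
      rw [abs_of_pos (Real.exp_pos _), Real.exp_le_exp]
      refine (le_abs_self _).trans ((abs_sum_mul_le (K := |K|) (fun k => ?_) _).trans
        (mul_le_mul_of_nonneg_left (hω t t.2) (abs_nonneg K)))
      exact (norm_le_pi_norm (β t) k).trans ((hK t t.2).trans (le_abs_self K))
  · obtain ⟨L, hL, hUL⟩ := exists_enorm_utility_sq_le κ i
    have hm : Measurable[𝔽 T.toNNReal] fun ω =>
        κ.utility i (X T ω i) (othersMean i fun k => X T ω k) :=
      (measurable_utility κ i).comp (hXc.1 T hTmem)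
    refine ⟨hm, (hm.mono (𝔽.le _) le_rfl).aestronglyMeasurable, ?_⟩
    rw [eLpNorm_lt_top_iff_lintegral_rpow_enorm_lt_top (by norm_num) (by norm_num)]
    refine hM.lintegral_lt_top hL ENNReal.one_ne_top ?_
    filter_upwards [hXM] with ω hω
    rw [one_mul]
    simpa using hUL (fun k => X T ω k) (M ω) (hω T hTmem)
  · obtain ⟨L, hL, hUL⟩ := exists_enorm_utility_sq_le κ i
    have hDc : ∀ i j, ContinuousOn (fun t => κ.loading i (Pol i t) j) (Set.Icc t₀ T) :=
      fun i j => (κ.continuous_loading i j).comp_continuousOn ((hDF i).1.mono hsub)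
    -- The controls are frozen along `X`, so `Y` has the same drift process and diffusion as `X`,
    -- and no Gronwall argument is needed.
    have hYX : ∀ᵐ ω ∂P, ∀ t ∈ Set.Icc t₀ T, Y t ω = X t ω :=
      IsItoProcess.ae_eq hZ ht₀ ht₀T.le hDc hY hX
    refine hM.lintegral_lt_top hL (C := ENNReal.ofReal (T - t₀) + 1) (by simp) ?_
    filter_upwards [hXM, hcM, hYX] with ω h1 h2 h3
    rw [h3 T hTmem, add_mul, one_mul]
    refine add_le_add (htime fun t ht => ?_) (hUL (fun k => X T ω k) (M ω) (h1 T hTmem))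
    exact hUL (fun k => Con k t (X t ω)) (M ω) (h2 t ht)
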